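/- Let $\mathcal C$ be a symmetric monoidal category (product $\otimes$, unit $1$) that has all small limits, and let $\star_{\mathcal C}$ be its final object. **Symmetric sequences, wreath products.** Let $\Sigma_*$ be the category of finite sets and bijections and $\Sigma_0\subset\Sigma_*$ the full subcategory of empty sets. A symmetric sequence is a functor $\Sigma_*\to\mathcal C$. For a category $A$, the wreath product $\Sigma_*\wr A$ has as objects the finite families $\{a_s\}_{s\in S}$ of objects of $A$, and as morphisms $\{a_s\}_{S}\to\{b_t\}_{T}$ the bijections $\sigma:S\to T$ with morphisms $a_s\to b_{\sigma(s)}$. For functors $O:\Sigma_*\to\mathcal C$ and $F:A\to\mathcal C$ put $$O\circledcirc F:\Sigma_*\wr A\to\mathcal C,\qquad \{a_s\}_{s\in S}\mapsto O(S)\otimes\bigotimes_{s\in S}F(a_s)$$ (unordered tensor product). Let $\gamma^2:\Sigma_*\wr\Sigma_*\to\Sigma_*$ be $\{S_t\}_{t\in T}\mapsto\coprod_tS_t$; more generally $\gamma^2\wr\mathrm{Id}:\Sigma_*\wr\Sigma_*\wr A\to\Sigma_*\wr A$ turns a family of families into one family, and $s_0:A\to\Sigma_*\wr A$ is $a\mapsto\{a\}$.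 Let $\mathbb 1$ be the symmetric sequence with $\mathbb 1(T)=1$ if $|T|=1$ and $\mathbb 1(T)=\star_{\mathcal C}$ otherwise. **Cooperads and coalgebras.** A counital cooperad is a symmetric sequence $\mathcal O$ with natural transformations $\tilde\Delta:\mathcal O\gamma^2\to\mathcal O\circledcirc\mathcal O$ and $\tilde\epsilon:\mathcal O\to\mathbb 1$ such that the two composites $\mathcal O\gamma^3\to\mathcal O\circledcirc\mathcal O\circledcirc\mathcal O$, where $\gamma^3=\gamma^2(\gamma^2\wr\mathrm{Id})\cong\gamma^2(\mathrm{Id}\wr\gamma^2)$, agree, and such that applying $\tilde\Delta$ to $\{S\}$, respectively to $\{\star\}_{s\in S}$ (with $\star$ a one-point set), followed by $\tilde\epsilon$ on the first factor, respectively on the factors $\mathcal O(\star)$, is the identity of $\mathcal O(S)$ for every finite set $S$. A coalgebra over $\mathcal O$ is an object $c$ of $\mathcal C$, viewed as a constant functor on $\Sigma_0$, with a natural transformation $\tilde\Delta_c:c\,\bar\gamma^2\to\mathcal O\circledcirc c$ of functors on $\Sigma_*\wr\Sigma_0$ ($\bar\gamma^2$ being the functor to $\Sigma_0$), such that the two composites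 $c\,\bar\gamma^3\to\mathcal O\circledcirc\mathcal O\circledcirc c$, through $(\mathcal O\circledcirc c)(\gamma^2\wr\mathrm{Id})$ and through $(\mathcal O\circledcirc c)(\mathrm{Id}\wr\bar\gamma^2)$, agree and such that $c=c\,\bar\gamma^2 s_0\to(\mathcal O\circledcirc c)s_0\to(\mathbb 1\circledcirc c)s_0=c$ is the identity. **Leafless trees and the terms.** For $n\ge0$ let $\hat\emptyset_{n+1}$ be the category of leafless trees of level $n+1$ and isomorphisms, i.e. of chains $\star\leftarrow S_1\leftarrow\cdots\leftarrow S_n\leftarrow\emptyset$ of finite sets and isomorphisms of chains, realized as $\Sigma_*\wr(\cdots\wr(\Sigma_*\wr\Sigma_0))$ with $n$ factors $\Sigma_*$. Let $\bar\gamma:\hat\emptyset_{n+1}\to\Sigma_0$ be the functor which forgets $S_1,\dots,S_n$. On $\hat\emptyset_{n+1}$ there is the functor $\mathcal O^{\circledcirc n}\circledcirc c$ (with value $c$ for $n=0$); let $\mathcal O^{\hat\circ n}\,\hat\circ\,c\in\mathcal C$ be the value at $\emptyset$ of its right Kan extension along $\bar\gamma$. **Structure maps.** For $0\le i\le n$ let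 $\partial_i:\hat\emptyset_{n+2}\to\hat\emptyset_{n+1}$ forget $S_{i+1}$ and let $s_i:\hat\emptyset_{n+1}\to\hat\emptyset_{n+2}$ double $S_i$ (where $S_0=\star$); both commute with the functors $\bar\gamma$. Applying $\tilde\Delta$ to the $i$-th factor $\mathcal O$ (counted from $0$) if $i<n$, or $\tilde\Delta_c$ to $c$ if $i=n$, gives $(\mathcal O^{\circledcirc n}\circledcirc c)\,\partial_i\to\mathcal O^{\circledcirc(n+1)}\circledcirc c$; applying $\tilde\epsilon$ to the $i$-th factor gives $(\mathcal O^{\circledcirc(n+1)}\circledcirc c)\,s_i\to\mathcal O^{\circledcirc n}\circledcirc c$. By the universal property of right Kan extensions these induce $$\Delta_i:\mathcal O^{\hat\circ n}\hat\circ c\to\mathcal O^{\hat\circ(n+1)}\hat\circ c,\qquad \epsilon_i:\mathcal O^{\hat\circ(n+1)}\hat\circ c\to\mathcal O^{\hat\circ n}\hat\circ c\qquad(0\le i\le n).$$ For $n=0$, where $\mathcal O^{\hat\circ0}\hat\circ c=c$, these are $\Delta_c:c\to\mathcal O\,\hat\circ\,c$ and $\epsilon_c:\mathcal O\,\hat\circ\,c\to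 c$. **Theorem.** For every coalgebra $c$ over a counital cooperad $\mathcal O$ in $\mathcal C$, the objects $X^n=\mathcal O^{\hat\circ(n+1)}\,\hat\circ\,c$ $(n\ge0)$, with cofaces $d^i=\Delta_i:X^n\to X^{n+1}$ $(0\le i\le n+1)$, codegeneracies $\sigma^j=\epsilon_{j+1}:X^{n+1}\to X^n$ $(0\le j\le n)$ and coaugmentation $\Delta_c:c\to X^0$, form a coaugmented cosimplicial object of $\mathcal C$. Moreover the remaining maps $\epsilon_0:X^{n+1}\to X^n$ and $\epsilon_c:X^0\to c$ form an extra codegeneracy: $$\epsilon_c\Delta_c=\mathrm{id}_c,\qquad \epsilon_0d^0=\mathrm{id}_{X^n},\qquad \epsilon_0d^1=\Delta_c\epsilon_c\ \text{ on } X^0,\qquad \epsilon_0d^{i+1}=d^i\epsilon_0:X^{n+1}\to X^{n+1}\ (0\le i\le n+1),$$ $$\epsilon_c\sigma^0=\epsilon_c\epsilon_0\ \text{ on } X^1,\qquad \epsilon_0\sigma^{j+1}=\sigma^j\epsilon_0:X^{n+2}\to X^n\ (0\le j\le n).$$ -/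

import Mathlib

open CategoryTheory MonoidalCategory Limits

universe v u

/-!
Conventions. `C` is a symmetric monoidal category. Finite sets are finite types in `Type`.
Contents:
* unordered tensor products `tens` over finite sets in `C`, with the coherence isomorphisms
  between them;
* the groupoid `FinBij` (written `Σ_*`) and wreath product categories `Wreath A` (`Σ_* ≀ A`);
* the products `circ O F` (`O ⊚ F`), counital cooperads and their coalgebras;
* the categories `Level n` of leafless trees, with their face and degeneracy functors, and the
  right Kan extensions of the functors `O ⊚ ⋯ ⊚ O ⊚ c` on them, with the induced cofaces and
  codegeneracies.
-/

namespace TreeCooperad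

/-! ## Unordered tensor products

To speak of the tensor product of a family indexed by a finite set, we use formal bracketed
products (`Word`), formal composites of the structure isomorphisms of a symmetric monoidal
category between them (`FHom`), and the coherence theorem. -/

/-- Formal bracketed products of elements of `S`. -/
inductive Word (S : Type) : Type
  | one : Word S
  | of : S → Word S
  | mul : Word S → Word S → Word S

namespace Word

variable {S T U : Type}

/-- Substitution. -/
def bind (k : S → Word T) : Word S → Word T
  | one => one
  | of s => k s
  | mul e e' => mul (bind k e) (bind k e')

/-- The factors of `e`, from left to right, followed by the list `l`. -/
def flat : Word S → List S → List S
  | one, l => l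
  | of s, l => s :: l
  | mul e e', l => flat e (flat e' l)

/-- The right-bracketed product of a list. -/
def ofList : List S → Word S
  | [] => one
  | s :: l => mul (of s) (ofList l)

theorem bind_of (e : Word S) : e.bind of = e := by
  induction e with
  | one => rfl
  | of s => rfl
  | mul e e' h h' => simp [bind, h, h']

theorem bind_bind (k : S → Word T) (k' : T → Word U) (e : Word S) :
    (e.bind k).bind k' = e.bind (fun s => (k s).bind k') := by
  induction e with
  | one => rfl
  | of s => rfl
  | mul e e' h h' => simp [bind, h, h']

theorem flat_append (e : Word S) (l : List S) : e.flat l = e.flat [] ++ l := by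
  induction e generalizing l with
  | one => rfl
  | of s => rfl
  | mul e e' h h' => rw [flat, flat, h, h (e'.flat []), h', List.append_assoc]

theorem flat_ofList (l : List S) : (ofList l).flat [] = l := by
  induction l with
  | nil => rfl
  | cons s l h => simp [ofList, flat, h]

theorem flat_bind (k : S → Word T) (e : Word S) :
    (e.bind k).flat [] = (e.flat []).flatMap (fun s => (k s).flat []) := by
  induction e with
  | one => rfl
  | of s => simp [bind, flat]
  | mul e e' h h' =>
    rw [bind, flat, flat_append, h, h', flat, flat_append e (e'.flat []), List.flatMap_append]

/-- Formal composites of associators, unitors, braidings and their tensor products. -/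
inductive FHom : Word S → Word S → Type
  | id (e) : FHom e e
  | comp {e e' e''} : FHom e e' → FHom e' e'' → FHom e e''
  | tensor {a a' b b'} : FHom a a' → FHom b b' → FHom (mul a b) (mul a' b')
  | assoc (a b c) : FHom (mul (mul a b) c) (mul a (mul b c))
  | assocInv (a b c) : FHom (mul a (mul b c)) (mul (mul a b) c)
  | leftU (a) : FHom (mul one a) a
  | leftUInv (a) : FHom a (mul one a)
  | rightU (a) : FHom (mul a one) a
  | rightUInv (a) : FHom a (mul a one)
  | braid (a b) : FHom (mul a b) (mul b a)

theorem FHom.normal (e : Word S) (l : List S) :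
    Nonempty (FHom (mul e (ofList l)) (ofList (e.flat l))) ∧
      Nonempty (FHom (ofList (e.flat l)) (mul e (ofList l))) := by
  induction e generalizing l with
  | one => exact ⟨⟨.leftU _⟩, ⟨.leftUInv _⟩⟩
  | of s => exact ⟨⟨.id _⟩, ⟨.id _⟩⟩
  | mul a b ha hb =>
    obtain ⟨⟨f⟩, ⟨f'⟩⟩ := hb l
    obtain ⟨⟨g⟩, ⟨g'⟩⟩ := ha (b.flat l)
    exact ⟨⟨(FHom.assoc _ _ _).comp (((FHom.id a).tensor f).comp g)⟩,
      ⟨g'.comp (((FHom.id a).tensor f').comp (FHom.assocInv _ _ _))⟩⟩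

theorem FHom.ofPerm {l l' : List S} (h : l.Perm l') : Nonempty (FHom (ofList l) (ofList l')) := by
  induction h with
  | nil => exact ⟨.id _⟩
  | cons s _ ih => obtain ⟨f⟩ := ih; exact ⟨(FHom.id _).tensor f⟩
  | swap a b l =>
    exact ⟨(FHom.assocInv _ _ _).comp (((FHom.braid _ _).tensor (.id _)).comp (FHom.assoc _ _ _))⟩
  | trans _ _ h h' => obtain ⟨f⟩ := h; obtain ⟨g⟩ := h'; exact ⟨f.comp g⟩

theorem FHom.exists_of_perm {e e' : Word S} (h : (e.flat []).Perm (e'.flat [])) :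
    Nonempty (FHom e e') := by
  obtain ⟨⟨f⟩, -⟩ := FHom.normal e []
  obtain ⟨-, ⟨g⟩⟩ := FHom.normal e' []
  obtain ⟨p⟩ := FHom.ofPerm h
  exact ⟨(FHom.rightUInv e).comp (f.comp (p.comp (g.comp (.rightU _))))⟩

/-- Substitution. -/
def FHom.bind (k : S → Word T) : ∀ {e e' : Word S}, FHom e e' → FHom (e.bind k) (e'.bind k)
  | _, _, .id e => .id _
  | _, _, .comp f g => .comp (f.bind k) (g.bind k)
  | _, _, .tensor f g => .tensor (f.bind k) (g.bind k)
  | _, _, .assoc a b c => .assoc _ _ _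
  | _, _, .assocInv a b c => .assocInv _ _ _
  | _, _, .leftU a => .leftU _
  | _, _, .leftUInv a => .leftUInv _
  | _, _, .rightU a => .rightU _
  | _, _, .rightUInv a => .rightUInv _
  | _, _, .braid a b => .braid _ _

variable {C : Type u} [Category.{v} C] [MonoidalCategory C]

/-- The product in `C` denoted by a formal product, for a family of factors `X`. -/
def ev (X : S → C) : Word S → C
  | one => 𝟙_ C
  | of s => X s
  | mul e e' => ev X e ⊗ ev X e'

/-- The tensor product of the morphisms `φ s`, one for each factor of the product. -/
def evBind {X : S → C} {Y : T → C} (k : S → Word T) (φ : ∀ s, X s ⟶ (k s).ev Y) :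
    ∀ e : Word S, e.ev X ⟶ (e.bind k).ev Y
  | one => 𝟙 (𝟙_ C)
  | of s => φ s
  | mul e e' => evBind k φ e ⊗ₘ evBind k φ e'

variable [SymmetricCategory C]

/-- The morphism of `C` denoted by a formal composite of structure isomorphisms. -/
def FHom.interp (X : S → C) : ∀ {e e' : Word S}, FHom e e' → (e.ev X ⟶ e'.ev X)
  | _, _, .id e => 𝟙 (e.ev X)
  | _, _, .comp f g => f.interp X ≫ g.interp X
  | _, _, .tensor f g => f.interp X ⊗ₘ g.interp X
  | _, _, .assoc a b c => (α_ (a.ev X) (b.ev X) (c.ev X)).hom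
  | _, _, .assocInv a b c => (α_ (a.ev X) (b.ev X) (c.ev X)).inv
  | _, _, .leftU a => (λ_ (a.ev X)).hom
  | _, _, .leftUInv a => (λ_ (a.ev X)).inv
  | _, _, .rightU a => (ρ_ (a.ev X)).hom
  | _, _, .rightUInv a => (ρ_ (a.ev X)).inv
  | _, _, .braid a b => (β_ (a.ev X) (b.ev X)).hom

theorem interp_evBind {X : S → C} {Y : T → C} (k : S → Word T) (φ : ∀ s, X s ⟶ (k s).ev Y)
    {e e' : Word S} (f : FHom e e') :
    f.interp X ≫ evBind k φ e' = evBind k φ e ≫ (f.bind k).interp Y := by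
  induction f with
  | id e => exact (Category.id_comp _).trans (Category.comp_id _).symm
  | comp f g hf hg =>
    simp only [FHom.interp, FHom.bind, Category.assoc, hg]
    rw [← Category.assoc, hf, Category.assoc]
  | tensor f g hf hg =>
    simp only [FHom.interp, FHom.bind, evBind]
    erw [tensorHom_comp_tensorHom, hf, hg, ← tensorHom_comp_tensorHom]; rfl
  | assoc a b c => exact (associator_naturality _ _ _).symm
  | assocInv a b c => exact (associator_inv_naturality _ _ _).symm
  | leftU a =>
    have := leftUnitor_naturality (evBind k φ a)
    rw [← id_tensorHom] at this
    exact this.symm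
  | leftUInv a =>
    have := leftUnitor_inv_naturality (evBind k φ a)
    rw [← id_tensorHom] at this
    exact this.symm
  | rightU a =>
    have := rightUnitor_naturality (evBind k φ a)
    rw [← tensorHom_id] at this
    exact this.symm
  | rightUInv a =>
    have := rightUnitor_inv_naturality (evBind k φ a)
    rw [← tensorHom_id] at this
    exact this.symm
  | braid a b => exact (BraidedCategory.braiding_naturality _ _).symm

/-! ### Coherence for symmetric monoidal categories

Two composites of structure isomorphisms between the same products agree, if no factor is
repeated. -/

/-- The exchange of the first two factors. -/
def sw (a b c : C) : a ⊗ (b ⊗ c) ⟶ b ⊗ (a ⊗ c) :=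
  (α_ a b c).inv ≫ ((β_ a b).hom ▷ c) ≫ (α_ b a c).hom

theorem sw_sw (a b c : C) : sw a b c ≫ sw b a c = 𝟙 _ := by
  simp [sw, ← comp_whiskerRight_assoc]

theorem sw_sw_assoc (a b c : C) {d : C} (f : a ⊗ (b ⊗ c) ⟶ d) :
    sw a b c ≫ sw b a c ≫ f = f := by
  rw [← Category.assoc, sw_sw, Category.id_comp]

theorem sw_nat (a b : C) {c d : C} (f : c ⟶ d) :
    sw a b c ≫ (b ◁ a ◁ f) = (a ◁ b ◁ f) ≫ sw a b d := by
  simp only [sw, Category.assoc]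
  rw [← associator_naturality_right, ← whisker_exchange_assoc, associator_inv_naturality_right_assoc]

theorem sw_nat_assoc (a b : C) {c d e : C} (f : c ⟶ d) (g : b ⊗ (a ⊗ d) ⟶ e) :
    sw a b c ≫ (b ◁ a ◁ f) ≫ g = (a ◁ b ◁ f) ≫ sw a b d ≫ g := by
  rw [← Category.assoc, sw_nat, Category.assoc]

theorem sw_yb (a b c d : C) :
    (a ◁ sw b c d) ≫ sw a c (b ⊗ d) ≫ (c ◁ sw a b d) =
      sw a b (c ⊗ d) ≫ (b ◁ sw a c d) ≫ sw b c (a ⊗ d) := by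
  have h := congr_arg (fun f => (α_ a b (c ⊗ d)).inv ≫ (α_ (a ⊗ b) c d).inv ≫
    ((α_ a b c).hom ≫ f) ▷ d ≫ (α_ c (b ⊗ a) d).hom ≫ c ◁ (α_ b a d).hom)
    (BraidedCategory.yang_baxter a b c)
  simp only [sw]
  refine Eq.trans ?_ (h.symm.trans ?_) <;> monoidal

theorem sw_yb_assoc (a b c d : C) {e : C} (f : c ⊗ (b ⊗ (a ⊗ d)) ⟶ e) :
    (a ◁ sw b c d) ≫ sw a c (b ⊗ d) ≫ (c ◁ sw a b d) ≫ f =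
      sw a b (c ⊗ d) ≫ (b ◁ sw a c d) ≫ sw b c (a ⊗ d) ≫ f := by
  have h := congr_arg (· ≫ f) (sw_yb a b c d)
  simpa only [Category.assoc] using h

theorem exch_aux {a b d l l₁ l₂ m : C} (i : a ⊗ l ⟶ l₁) (j : b ⊗ l₁ ⟶ l₂) (i' : b ⊗ l ⟶ m)
    (j' : a ⊗ m ⟶ l₂) (h : (b ◁ i) ≫ j = sw b a l ≫ (a ◁ i') ≫ j') :
    (b ◁ (sw a d l ≫ (d ◁ i))) ≫ sw b d l₁ ≫ (d ◁ j) =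
      sw b a (d ⊗ l) ≫ (a ◁ (sw b d l ≫ (d ◁ i'))) ≫ sw a d m ≫ (d ◁ j') := by
  simp only [MonoidalCategory.whiskerLeft_comp, Category.assoc]
  rw [← sw_nat_assoc, ← MonoidalCategory.whiskerLeft_comp, h, ← sw_nat_assoc]
  simp only [MonoidalCategory.whiskerLeft_comp]
  rw [sw_yb_assoc]

/-- The right-bracketed tensor product of a list of factors. -/
def lprod (X : S → C) : List S → C
  | [] => 𝟙_ C
  | s :: l => X s ⊗ lprod X l

/-- `Ins a l l'`: the list `l'` arises from `l` by inserting `a` somewhere. -/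
inductive Ins (a : S) : List S → List S → Type
  | here (l) : Ins a l (a :: l)
  | there (b) {l l'} : Ins a l l' → Ins a (b :: l) (b :: l')

/-- The isomorphism that moves the first factor to the place where it is inserted. -/
def Ins.ev (X : S → C) {a : S} : ∀ {l l' : List S}, Ins a l l' → (X a ⊗ lprod X l ⟶ lprod X l')
  | _, _, .here l => 𝟙 (X a ⊗ lprod X l)
  | _, _, .there (l := l) b i => sw (X a) (X b) (lprod X l) ≫ (X b ◁ i.ev X)

theorem here_aux {a b l m : C} (i : a ⊗ l ⟶ m) :
    (b ◁ i) ≫ 𝟙 (b ⊗ m) = sw b a l ≫ (a ◁ 𝟙 (b ⊗ l)) ≫ sw a b l ≫ (b ◁ i) := by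
  simp [sw_sw_assoc]

theorem here_aux' {a b l m : C} (j : b ⊗ l ⟶ m) :
    (b ◁ 𝟙 (a ⊗ l)) ≫ sw b a l ≫ (a ◁ j) = sw b a l ≫ (a ◁ j) ≫ 𝟙 (a ⊗ m) := by
  simp

theorem Ins.exchange (X : S → C) {a b : S} {l l₁ l₂ : List S} (i : Ins a l l₁) (j : Ins b l₁ l₂) :
    ∃ (l₁' : List S) (i' : Ins b l l₁') (j' : Ins a l₁' l₂),
      (X b ◁ i.ev X) ≫ j.ev X = sw (X b) (X a) (lprod X l) ≫ (X a ◁ i'.ev X) ≫ j'.ev X := by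
  induction j generalizing l with
  | here l₁ => exact ⟨_, .here _, .there _ i, here_aux (i.ev X)⟩
  | there d j ih =>
    cases i with
    | here => exact ⟨_, j, .here _, here_aux' (j.ev X)⟩
    | there _ i =>
      obtain ⟨m, i', j', h⟩ := ih i
      exact ⟨_, .there d i', .there d j', exch_aux _ _ _ _ h⟩

/-- The canonical permutation morphisms between right-bracketed products. -/
inductive Perm (X : S → C) : ∀ l l' : List S, (lprod X l ⟶ lprod X l') → Prop
  | nil : Perm X [] [] (𝟙 (𝟙_ C))
  | cons {a : S} {l m l' : List S} (i : Ins a m l') {f : lprod X l ⟶ lprod X m} :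
      Perm X l m f → Perm X (a :: l) l' ((X a ◁ f) ≫ i.ev X)

theorem Perm.refl (X : S → C) (l : List S) : Perm X l l (𝟙 _) := by
  induction l with
  | nil => exact .nil
  | cons a l ih =>
    have := Perm.cons (.here (a := a) l) ih
    have h : (X a ◁ (𝟙 (lprod X l))) ≫ 𝟙 (X a ⊗ lprod X l) = 𝟙 (X a ⊗ lprod X l) := by simp
    exact h ▸ this

theorem pull_aux {a b m l n n1 l' : C} (i : a ⊗ m ⟶ l) (g0 : l ⟶ n) (k : b ⊗ n ⟶ l') {n0 : C}
    (g0' : m ⟶ n0) (j0 : a ⊗ n0 ⟶ n) (h : i ≫ g0 = (a ◁ g0') ≫ j0)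
    (j0' : b ⊗ n0 ⟶ n1) (k' : a ⊗ n1 ⟶ l')
    (h' : (b ◁ j0) ≫ k = sw b a n0 ≫ (a ◁ j0') ≫ k') :
    (sw a b m ≫ (b ◁ i)) ≫ (b ◁ g0) ≫ k = (a ◁ ((b ◁ g0') ≫ j0')) ≫ k' := by
  simp only [Category.assoc]
  rw [← MonoidalCategory.whiskerLeft_comp_assoc, h, MonoidalCategory.whiskerLeft_comp,
    Category.assoc, h', sw_nat_assoc, sw_sw_assoc]
  simp

theorem Perm.pull (X : S → C) {l' l'' : List S} {g : lprod X l' ⟶ lprod X l''}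
    (hg : Perm X l' l'' g) {a : S} {m : List S} (i : Ins a m l') :
    ∃ (m' : List S) (g' : lprod X m ⟶ lprod X m') (j : Ins a m' l''),
      Perm X m m' g' ∧ i.ev X ≫ g = (X a ◁ g') ≫ j.ev X := by
  induction hg generalizing m with
  | nil => cases i
  | cons k hg0 ih =>
    cases i with
    | here => exact ⟨_, _, k, hg0, Category.id_comp _⟩
    | there b i =>
      obtain ⟨n0, g0', j0, hp, h⟩ := ih i
      obtain ⟨n1, j0', k', h'⟩ := Ins.exchange X j0 k
      exact ⟨_, _, k', .cons j0' hp, pull_aux _ _ _ _ _ h _ _ h'⟩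

theorem trans_aux {a l m l' l'' m' : C} (f : l ⟶ m) (i : a ⊗ m ⟶ l') (g : l' ⟶ l'')
    (g' : m ⟶ m') (j : a ⊗ m' ⟶ l'') (h : i ≫ g = (a ◁ g') ≫ j) :
    (a ◁ (f ≫ g')) ≫ j = ((a ◁ f) ≫ i) ≫ g := by
  simp [h]

theorem Perm.trans (X : S → C) {l l' l'' : List S} {f : lprod X l ⟶ lprod X l'}
    {g : lprod X l' ⟶ lprod X l''} (hf : Perm X l l' f) (hg : Perm X l' l'' g) :
    Perm X l l'' (f ≫ g) := by
  induction hf generalizing l'' with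
  | nil => exact (Category.id_comp g).symm ▸ hg
  | @cons a l m l' i f hf ih =>
    obtain ⟨m', g', j, hp, h⟩ := hg.pull X i
    exact trans_aux f (i.ev X) g g' (j.ev X) h ▸ Perm.cons j (ih hp)

theorem Ins.mem {a : S} {l l' : List S} (i : Ins a l l') : l'.Perm (a :: l) := by
  induction i with
  | here => exact .refl _
  | there b i ih => exact (ih.cons b).trans (.swap _ _ _)

theorem Ins.unique {a : S} {l m l' : List S} (h : l'.Nodup) (i : Ins a l l') (j : Ins a m l') :
    l = m ∧ HEq i j := by
  induction i generalizing m with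
  | here l =>
    cases j with
    | here => exact ⟨rfl, HEq.rfl⟩
    | there _ j => exact absurd (j.mem.mem_iff.2 (by simp)) (List.nodup_cons.1 h).1
  | there b i ih =>
    cases j with
    | here => exact absurd (i.mem.mem_iff.2 (by simp)) (List.nodup_cons.1 h).1
    | there _ j =>
      obtain ⟨rfl, hij⟩ := ih (List.nodup_cons.1 h).2 j
      cases hij
      exact ⟨rfl, HEq.rfl⟩

theorem Perm.unique (X : S → C) {l l' : List S} (h : l'.Nodup) {f g : lprod X l ⟶ lprod X l'}
    (hf : Perm X l l' f) (hg : Perm X l l' g) : f = g := by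
  induction hf with
  | nil => cases hg; rfl
  | @cons a l m l' i f hf ih =>
    cases hg with
    | @cons _ _ m' _ j g hg =>
      obtain ⟨rfl, hij⟩ := Ins.unique h i j
      cases hij
      rw [ih (List.nodup_cons.1 (i.mem.nodup_iff.1 h)).2 hg]

/-- The associativity isomorphism to the right-bracketed product. -/
def nm (X : S → C) : ∀ (e : Word S) (l : List S), (e.ev X ⊗ lprod X l) ≅ lprod X (e.flat l)
  | one, l => λ_ (lprod X l)
  | of s, l => Iso.refl (X s ⊗ lprod X l)
  | mul a b, l => α_ (a.ev X) (b.ev X) (lprod X l) ≪≫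
      whiskerLeftIso (a.ev X) (nm X b l) ≪≫ nm X a (b.flat l)

/-- After right-bracketing, `f` becomes a permutation morphism. -/
def Good (X : S → C) {e e' : Word S} (f : e.ev X ⟶ e'.ev X) : Prop :=
  ∀ (l l' : List S) (g : lprod X l ⟶ lprod X l'), Perm X l l' g →
    Perm X (e.flat l) (e'.flat l') ((nm X e l).inv ≫ (f ⊗ₘ g) ≫ (nm X e' l').hom)

theorem Good.comp (X : S → C) {e e' e'' : Word S} {f : e.ev X ⟶ e'.ev X} {f' : e'.ev X ⟶ e''.ev X}
    (hf : Good X f) (hf' : Good X f') : Good X (f ≫ f') := by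
  intro l l' g hg
  have := (hf _ _ _ (Perm.refl X l)).trans X (hf' _ _ _ hg)
  have h : ((nm X e l).inv ≫ (f ⊗ₘ 𝟙 (lprod X l)) ≫ (nm X e' l).hom) ≫
      ((nm X e' l).inv ≫ (f' ⊗ₘ g) ≫ (nm X e'' l').hom) =
      (nm X e l).inv ≫ ((f ≫ f') ⊗ₘ g) ≫ (nm X e'' l').hom := by
    simp [MonoidalCategory.tensorHom_def]
  exact h ▸ this

theorem tensor_aux {A B L M N A' B' L' M' N' : C} (nB : B ⊗ L ≅ M) (nA : A ⊗ M ≅ N)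
    (nB' : B' ⊗ L' ≅ M') (nA' : A' ⊗ M' ≅ N') (f : A ⟶ A') (f' : B ⟶ B') (g : L ⟶ L') :
    nA.inv ≫ (f ⊗ₘ (nB.inv ≫ (f' ⊗ₘ g) ≫ nB'.hom)) ≫ nA'.hom =
      (α_ A B L ≪≫ whiskerLeftIso A nB ≪≫ nA).inv ≫ ((f ⊗ₘ f') ⊗ₘ g) ≫
        (α_ A' B' L' ≪≫ whiskerLeftIso A' nB' ≪≫ nA').hom := by
  simp only [MonoidalCategory.tensorHom_def, Iso.trans_inv, Iso.trans_hom, whiskerLeftIso_inv,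
    whiskerLeftIso_hom, MonoidalCategory.whiskerLeft_comp, Category.assoc]
  rw [← whisker_exchange_assoc]
  simp

theorem Good.tensor (X : S → C) {a a' b b' : Word S} {f : a.ev X ⟶ a'.ev X}
    {f' : b.ev X ⟶ b'.ev X} (hf : Good X f) (hf' : Good X f') :
    Good X (e := mul a b) (e' := mul a' b') (f ⊗ₘ f') := by
  intro l l' g hg
  exact tensor_aux (nm X b l) (nm X a _) (nm X b' l') (nm X a' _) f f' g ▸ hf _ _ _ (hf' _ _ _ hg)

theorem Good.id (X : S → C) (e : Word S) : Good X (𝟙 (e.ev X)) := by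
  induction e with
  | one =>
    intro l l' g hg
    have h : (λ_ (lprod X l)).inv ≫ (𝟙 (𝟙_ C) ⊗ₘ g) ≫ (λ_ (lprod X l')).hom = g := by simp
    exact h.symm ▸ hg
  | of s =>
    intro l l' g hg
    have h : 𝟙 (X s ⊗ lprod X l) ≫ (𝟙 (X s) ⊗ₘ g) ≫ 𝟙 (X s ⊗ lprod X l') =
      (X s ◁ g) ≫ 𝟙 (X s ⊗ lprod X l') := by simp
    exact h.symm ▸ Perm.cons (.here _) hg
  | mul a b ha hb =>
    have h : (𝟙 (a.ev X) ⊗ₘ 𝟙 (b.ev X)) = 𝟙 (a.ev X ⊗ b.ev X) := by simp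
    exact h ▸ ha.tensor X hb

theorem assoc_aux {A B K L M N P Q : C} (nC : K ⊗ L ≅ M) (nB : B ⊗ M ≅ N) (nA : A ⊗ N ≅ P)
    {L' : C} (g : L ⟶ L') (n' : (A ⊗ (B ⊗ K)) ⊗ L' ⟶ Q) :
    (α_ A (B ⊗ K) L ≪≫ whiskerLeftIso A (α_ B K L ≪≫ whiskerLeftIso B nC ≪≫ nB) ≪≫ nA).inv ≫
      (𝟙 (A ⊗ (B ⊗ K)) ⊗ₘ g) ≫ n' =
    (α_ (A ⊗ B) K L ≪≫ whiskerLeftIso (A ⊗ B) nC ≪≫ α_ A B M ≪≫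
      whiskerLeftIso A nB ≪≫ nA).inv ≫ ((α_ A B K).hom ⊗ₘ g) ≫ n' := by
  simp [MonoidalCategory.tensorHom_def]

theorem Good.assoc (X : S → C) (a b c : Word S) :
    Good X (e := mul (mul a b) c) (e' := mul a (mul b c))
      (α_ (a.ev X) (b.ev X) (c.ev X)).hom := by
  intro l l' g hg
  exact assoc_aux (nm X c l) (nm X b _) (nm X a _) g (nm X (mul a (mul b c)) l').hom ▸
    Good.id X (mul a (mul b c)) l l' g hg

theorem assocInv_aux {A B K L M N P Q : C} (nC : K ⊗ L ≅ M) (nB : B ⊗ M ≅ N) (nA : A ⊗ N ≅ P)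
    {L' : C} (g : L ⟶ L') (n' : ((A ⊗ B) ⊗ K) ⊗ L' ⟶ Q) :
    (α_ (A ⊗ B) K L ≪≫ whiskerLeftIso (A ⊗ B) nC ≪≫ α_ A B M ≪≫
      whiskerLeftIso A nB ≪≫ nA).inv ≫ (𝟙 ((A ⊗ B) ⊗ K) ⊗ₘ g) ≫ n' =
    (α_ A (B ⊗ K) L ≪≫ whiskerLeftIso A (α_ B K L ≪≫ whiskerLeftIso B nC ≪≫ nB) ≪≫ nA).inv ≫
      ((α_ A B K).inv ⊗ₘ g) ≫ n' := by
  simp [MonoidalCategory.tensorHom_def]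

theorem Good.assocInv (X : S → C) (a b c : Word S) :
    Good X (e := mul a (mul b c)) (e' := mul (mul a b) c)
      (α_ (a.ev X) (b.ev X) (c.ev X)).inv := by
  intro l l' g hg
  exact assocInv_aux (nm X c l) (nm X b _) (nm X a _) g (nm X (mul (mul a b) c) l').hom ▸
    Good.id X (mul (mul a b) c) l l' g hg

theorem left_aux {A L M Q L' : C} (nA : A ⊗ L ≅ M) (g : L ⟶ L') (n' : A ⊗ L' ⟶ Q) :
    nA.inv ≫ (𝟙 A ⊗ₘ g) ≫ n' =
      (α_ (𝟙_ C) A L ≪≫ whiskerLeftIso (𝟙_ C) nA ≪≫ λ_ M).inv ≫ ((λ_ A).hom ⊗ₘ g) ≫ n' := by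
  simp [MonoidalCategory.tensorHom_def]

theorem Good.left (X : S → C) (a : Word S) :
    Good X (e := mul one a) (e' := a) (λ_ (a.ev X)).hom := by
  intro l l' g hg
  exact left_aux (nm X a l) g (nm X a l').hom ▸ Good.id X a l l' g hg

theorem leftInv_aux {A L M Q L' : C} (nA : A ⊗ L ≅ M) (g : L ⟶ L') (n' : (𝟙_ C ⊗ A) ⊗ L' ⟶ Q) :
    (α_ (𝟙_ C) A L ≪≫ whiskerLeftIso (𝟙_ C) nA ≪≫ λ_ M).inv ≫ (𝟙 (𝟙_ C ⊗ A) ⊗ₘ g) ≫ n' =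
    nA.inv ≫ ((λ_ A).inv ⊗ₘ g) ≫ n' := by
  simp [MonoidalCategory.tensorHom_def]

theorem Good.leftInv (X : S → C) (a : Word S) :
    Good X (e := a) (e' := mul one a) (λ_ (a.ev X)).inv := by
  intro l l' g hg
  exact leftInv_aux (nm X a l) g (nm X (mul one a) l').hom ▸ Good.id X (mul one a) l l' g hg

theorem right_aux {A L M Q L' : C} (nA : A ⊗ L ≅ M) (g : L ⟶ L') (n' : A ⊗ L' ⟶ Q) :
    nA.inv ≫ (𝟙 A ⊗ₘ g) ≫ n' =
      (α_ A (𝟙_ C) L ≪≫ whiskerLeftIso A (λ_ L) ≪≫ nA).inv ≫ ((ρ_ A).hom ⊗ₘ g) ≫ n' := by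
  simp [MonoidalCategory.tensorHom_def]

theorem Good.right (X : S → C) (a : Word S) :
    Good X (e := mul a one) (e' := a) (ρ_ (a.ev X)).hom := by
  intro l l' g hg
  exact right_aux (nm X a l) g (nm X a l').hom ▸ Good.id X a l l' g hg

theorem rightInv_aux {A L M Q L' : C} (nA : A ⊗ L ≅ M) (g : L ⟶ L') (n' : (A ⊗ 𝟙_ C) ⊗ L' ⟶ Q) :
    (α_ A (𝟙_ C) L ≪≫ whiskerLeftIso A (λ_ L) ≪≫ nA).inv ≫ (𝟙 (A ⊗ 𝟙_ C) ⊗ₘ g) ≫ n' =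
    nA.inv ≫ ((ρ_ A).inv ⊗ₘ g) ≫ n' := by
  simp [MonoidalCategory.tensorHom_def]

theorem Good.rightInv (X : S → C) (a : Word S) :
    Good X (e := a) (e' := mul a one) (ρ_ (a.ev X)).inv := by
  intro l l' g hg
  exact rightInv_aux (nm X a l) g (nm X (mul a one) l').hom ▸ Good.id X (mul a one) l l' g hg

theorem braid_aux {A B L L' : C} (g : L ⟶ L') :
    (A ◁ ((B ◁ g) ≫ 𝟙 (B ⊗ L'))) ≫ sw A B L' ≫ (B ◁ 𝟙 (A ⊗ L')) =
    (α_ A B L ≪≫ whiskerLeftIso A (Iso.refl (B ⊗ L)) ≪≫ Iso.refl (A ⊗ (B ⊗ L))).inv ≫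
      ((β_ A B).hom ⊗ₘ g) ≫
        (α_ B A L' ≪≫ whiskerLeftIso B (Iso.refl (A ⊗ L')) ≪≫ Iso.refl (B ⊗ (A ⊗ L'))).hom := by
  simp [MonoidalCategory.tensorHom_def', sw]

theorem Good.braidOf (X : S → C) (s : S) (b : Word S) :
    Good X (e := mul (of s) b) (e' := mul b (of s)) (β_ (X s) (b.ev X)).hom := by
  induction b with
  | one =>
    have h : (ρ_ (X s)).hom ≫ (λ_ (X s)).inv = (β_ (X s) (𝟙_ C)).hom := by simp
    exact h ▸ (Good.right X (of s)).comp X (Good.leftInv X (of s))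
  | of t =>
    intro l l' g hg
    exact braid_aux g ▸ Perm.cons (.there t (.here (a := s) l')) (Perm.cons (.here (a := t) l') hg)
  | mul a b ha hb =>
    have h : (α_ (X s) (a.ev X) (b.ev X)).inv ≫ ((β_ (X s) (a.ev X)).hom ⊗ₘ 𝟙 (b.ev X)) ≫
        (α_ (a.ev X) (X s) (b.ev X)).hom ≫ (𝟙 (a.ev X) ⊗ₘ (β_ (X s) (b.ev X)).hom) ≫
        (α_ (a.ev X) (b.ev X) (X s)).inv = (β_ (X s) (a.ev X ⊗ b.ev X)).hom := by
      simp
    exact h ▸ (Good.assocInv X (of s) a b).comp X ((ha.tensor X (Good.id X b)).comp X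
      ((Good.assoc X a (of s) b).comp X (((Good.id X a).tensor X hb).comp X
        (Good.assocInv X a b (of s)))))

theorem Good.braid (X : S → C) (a b : Word S) :
    Good X (e := mul a b) (e' := mul b a) (β_ (a.ev X) (b.ev X)).hom := by
  induction a with
  | one =>
    have h : (λ_ (b.ev X)).hom ≫ (ρ_ (b.ev X)).inv = (β_ (𝟙_ C) (b.ev X)).hom := by simp
    exact h ▸ (Good.left X b).comp X (Good.rightInv X b)
  | of s => exact Good.braidOf X s b
  | mul a c ha hc =>
    have h : (α_ (a.ev X) (c.ev X) (b.ev X)).hom ≫ (𝟙 (a.ev X) ⊗ₘ (β_ (c.ev X) (b.ev X)).hom) ≫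
        (α_ (a.ev X) (b.ev X) (c.ev X)).inv ≫ ((β_ (a.ev X) (b.ev X)).hom ⊗ₘ 𝟙 (c.ev X)) ≫
        (α_ (b.ev X) (a.ev X) (c.ev X)).hom = (β_ (a.ev X ⊗ c.ev X) (b.ev X)).hom := by
      simp
    exact h ▸ (Good.assoc X a c b).comp X (((Good.id X a).tensor X hc).comp X
      ((Good.assocInv X a b c).comp X ((ha.tensor X (Good.id X c)).comp X
        (Good.assoc X b a c))))

theorem FHom.good (X : S → C) {e e' : Word S} (f : FHom e e') : Good X (f.interp X) := by
  induction f with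
  | id e => exact Good.id X e
  | comp f g hf hg => exact hf.comp X hg
  | tensor f g hf hg => exact hf.tensor X hg
  | assoc a b c => exact Good.assoc X a b c
  | assocInv a b c => exact Good.assocInv X a b c
  | leftU a => exact Good.left X a
  | leftUInv a => exact Good.leftInv X a
  | rightU a => exact Good.right X a
  | rightUInv a => exact Good.rightInv X a
  | braid a b => exact Good.braid X a b

/-- Coherence: parallel formal structure morphisms between expressions without repeated leaves
have the same interpretation. -/
theorem FHom.coherence (X : S → C) {e e' : Word S} (h : (e'.flat []).Nodup) (f g : FHom e e') :
    f.interp X = g.interp X := by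
  have key := (f.good X [] [] (𝟙 _) .nil).unique X h (g.good X [] [] (𝟙 _) .nil)
  have key' : (f.interp X ⊗ₘ 𝟙 (𝟙_ C)) = (g.interp X ⊗ₘ 𝟙 (𝟙_ C)) :=
    (Iso.cancel_iso_hom_right _ _ (nm X e' [])).1 ((Iso.cancel_iso_inv_left (nm X e []) _ _).1 key)
  rw [tensorHom_id, tensorHom_id] at key'
  exact (MonoidalCategory.whiskerRight_iff _ _).1 key'

/-! ### Morphisms determined by what they do on the factors -/

theorem evBind_evBind {X : S → C} {Y : T → C} {Z : U → C} (k : S → Word T)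
    (φ : ∀ s, X s ⟶ (k s).ev Y) (k' : T → Word U) (φ' : ∀ t, Y t ⟶ (k' t).ev Z) (e : Word S) :
    ∃ f : FHom (e.bind fun s => (k s).bind k') ((e.bind k).bind k'),
      evBind k φ e ≫ evBind k' φ' (e.bind k) =
        evBind (fun s => (k s).bind k') (fun s => φ s ≫ evBind k' φ' (k s)) e ≫ f.interp Z := by
  induction e with
  | one => exact ⟨.id _, rfl⟩
  | of s => exact ⟨.id _, (Category.comp_id _).symm⟩
  | mul a b ha hb =>
    obtain ⟨f, hf⟩ := ha
    obtain ⟨g, hg⟩ := hb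
    refine ⟨.tensor f g, ?_⟩
    have := congr_arg₂ (fun x y => x ⊗ₘ y) hf hg
    exact (tensorHom_comp_tensorHom _ _ _ _).trans
      (this.trans (tensorHom_comp_tensorHom _ _ _ _).symm)

theorem evBind_of (X : S → C) (e : Word S) :
    ∃ f : FHom (e.bind of) e, 𝟙 (e.ev X) =
      evBind (X := X) (Y := X) of (fun s => 𝟙 (X s)) e ≫ f.interp X := by
  induction e with
  | one => exact ⟨.id _, (Category.comp_id _).symm⟩
  | of s => exact ⟨.id _, (Category.comp_id _).symm⟩
  | mul a b ha hb =>
    obtain ⟨f, hf⟩ := ha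
    obtain ⟨g, hg⟩ := hb
    refine ⟨.tensor f g, ?_⟩
    have := congr_arg₂ (fun x y => x ⊗ₘ y) hf hg
    exact (id_tensorHom_id _ _).symm.trans (this.trans (tensorHom_comp_tensorHom _ _ _ _).symm)

theorem evBind_congr {X : S → C} {Y : T → C} (k k' : S → Word T)
    (φ : ∀ s, X s ⟶ (k s).ev Y) (φ' : ∀ s, X s ⟶ (k' s).ev Y) (h : ∀ s, FHom (k s) (k' s))
    (hφ : ∀ s, φ' s = φ s ≫ (h s).interp Y) (e : Word S) :
    ∃ f : FHom (e.bind k) (e.bind k'), evBind k' φ' e = evBind k φ e ≫ f.interp Y := by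
  induction e with
  | one => exact ⟨.id _, (Category.comp_id _).symm⟩
  | of s => exact ⟨h s, hφ s⟩
  | mul a b ha hb =>
    obtain ⟨f, hf⟩ := ha
    obtain ⟨g, hg⟩ := hb
    refine ⟨.tensor f g, ?_⟩
    have := congr_arg₂ (fun x y => x ⊗ₘ y) hf hg
    exact this.trans (tensorHom_comp_tensorHom _ _ _ _).symm

theorem evBind_isIso {X : S → C} {Y : T → C} (k : S → Word T)
    (φ : ∀ s, X s ⟶ (k s).ev Y) [∀ s, IsIso (φ s)] (e : Word S) : IsIso (evBind k φ e) := by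
  induction e with
  | one => exact inferInstanceAs (IsIso (𝟙 (𝟙_ C)))
  | of s => exact inferInstanceAs (IsIso (φ s))
  | mul a b ha hb => exact inferInstanceAs (IsIso (evBind k φ a ⊗ₘ evBind k φ b))

/-- `m` is, up to the coherence isomorphisms, the tensor product of the morphisms `φ s`. -/
def Rep {X : S → C} {Y : T → C} (k : S → Word T) (φ : ∀ s, X s ⟶ (k s).ev Y)
    {e : Word S} {e' : Word T} (m : e.ev X ⟶ e'.ev Y) : Prop :=
  ∃ f : FHom (e.bind k) e', m = evBind k φ e ≫ f.interp Y

theorem Rep.unique {X : S → C} {Y : T → C} {k : S → Word T} {φ : ∀ s, X s ⟶ (k s).ev Y}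
    {e : Word S} {e' : Word T} {m m' : e.ev X ⟶ e'.ev Y} (h : Rep k φ m) (h' : Rep k φ m')
    (he : (e'.flat []).Nodup) : m = m' := by
  obtain ⟨f, rfl⟩ := h
  obtain ⟨f', rfl⟩ := h'
  rw [f.coherence Y he f']

theorem Rep.comp {X : S → C} {Y : T → C} {Z : U → C} {k : S → Word T}
    {φ : ∀ s, X s ⟶ (k s).ev Y} {k' : T → Word U} {φ' : ∀ t, Y t ⟶ (k' t).ev Z}
    {e : Word S} {e' : Word T} {e'' : Word U} {m : e.ev X ⟶ e'.ev Y} {m' : e'.ev Y ⟶ e''.ev Z}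
    (h : Rep k φ m) (h' : Rep k' φ' m') :
    Rep (fun s => (k s).bind k') (fun s => φ s ≫ evBind k' φ' (k s)) (m ≫ m') := by
  obtain ⟨f, rfl⟩ := h
  obtain ⟨f', rfl⟩ := h'
  obtain ⟨g, hg⟩ := evBind_evBind k φ k' φ' e
  refine ⟨g.comp ((f.bind k').comp f'), ?_⟩
  have h := interp_evBind k' φ' f
  calc (evBind k φ e ≫ f.interp Y) ≫ (evBind k' φ' e' ≫ f'.interp Z)
      = evBind k φ e ≫ (f.interp Y ≫ evBind k' φ' e') ≫ f'.interp Z := by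
        simp only [Category.assoc]
    _ = (evBind k φ e ≫ evBind k' φ' (e.bind k)) ≫ (f.bind k').interp Z ≫ f'.interp Z := by
        rw [h]; simp only [Category.assoc]
    _ = _ := by rw [hg]; simp only [FHom.interp, Category.assoc]

theorem Rep.ofFHom (X : S → C) {e e' : Word S} (f : FHom e e') :
    Rep (X := X) (Y := X) of (fun s => 𝟙 (X s)) (f.interp X) := by
  obtain ⟨g, hg⟩ := evBind_of X e
  refine ⟨g.comp f, ?_⟩
  calc f.interp X = 𝟙 _ ≫ f.interp X := (Category.id_comp _).symm
    _ = _ := by rw [hg]; simp only [FHom.interp, Category.assoc]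

theorem Rep.congr {X : S → C} {Y : T → C} {k k' : S → Word T} {φ : ∀ s, X s ⟶ (k s).ev Y}
    {φ' : ∀ s, X s ⟶ (k' s).ev Y} {e : Word S} {e' : Word T} {m : e.ev X ⟶ e'.ev Y}
    (hm : Rep k' φ' m) (h : ∀ s, ∃ f : FHom (k s) (k' s), φ' s = φ s ≫ f.interp Y) :
    Rep k φ m := by
  choose h hφ using h
  obtain ⟨f, rfl⟩ := hm
  obtain ⟨g, hg⟩ := evBind_congr k k' φ φ' h hφ e
  exact ⟨g.comp f, by rw [hg]; simp only [FHom.interp, Category.assoc]⟩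

theorem Rep.congr' {X : S → C} {Y : T → C} {k : S → Word T} {φ φ' : ∀ s, X s ⟶ (k s).ev Y}
    {e : Word S} {e' : Word T} {m : e.ev X ⟶ e'.ev Y}
    (hm : Rep k φ' m) (h : ∀ s, φ' s = φ s) : Rep k φ m :=
  (funext h : φ' = φ) ▸ hm

theorem FHom.exists_inv (X : S → C) {e e' : Word S} (f : FHom e e') :
    ∃ g : FHom e' e, f.interp X ≫ g.interp X = 𝟙 _ := by
  induction f with
  | id e => exact ⟨.id _, Category.comp_id _⟩
  | comp f f' hf hf' =>
    obtain ⟨g, hg⟩ := hf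
    obtain ⟨g', hg'⟩ := hf'
    refine ⟨g'.comp g, ?_⟩
    simp only [FHom.interp, Category.assoc, reassoc_of% hg', hg]
  | tensor f f' hf hf' =>
    obtain ⟨g, hg⟩ := hf
    obtain ⟨g', hg'⟩ := hf'
    refine ⟨g.tensor g', ?_⟩
    exact (tensorHom_comp_tensorHom _ _ _ _).trans
      ((congr_arg₂ (fun x y => x ⊗ₘ y) hg hg').trans (id_tensorHom_id _ _))
  | assoc a b c => exact ⟨.assocInv _ _ _, Iso.hom_inv_id (α_ _ _ _)⟩
  | assocInv a b c => exact ⟨.assoc _ _ _, Iso.inv_hom_id (α_ _ _ _)⟩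
  | leftU a => exact ⟨.leftUInv _, Iso.hom_inv_id (λ_ _)⟩
  | leftUInv a => exact ⟨.leftU _, Iso.inv_hom_id (λ_ _)⟩
  | rightU a => exact ⟨.rightUInv _, Iso.hom_inv_id (ρ_ _)⟩
  | rightUInv a => exact ⟨.rightU _, Iso.inv_hom_id (ρ_ _)⟩
  | braid a b => exact ⟨.braid _ _, SymmetricCategory.symmetry _ _⟩

/-! ### Unordered tensor products -/

/-- `e` mentions each element of `S` exactly once. -/
def Full (e : Word S) : Prop := (e.flat []).Nodup ∧ ∀ s, s ∈ e.flat []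

theorem Full.perm {e e' : Word S} (h : e.Full) (h' : e'.Full) :
    (e.flat []).Perm (e'.flat []) :=
  (List.perm_ext_iff_of_nodup h.1 h'.1).2 fun s => ⟨fun _ => h'.2 s, fun _ => h.2 s⟩

theorem Full.bind {e : Word S} (he : e.Full) {k : S → Word T}
    (h₁ : ∀ s, ((k s).flat []).Nodup)
    (h₂ : ∀ s s' t, t ∈ (k s).flat [] → t ∈ (k s').flat [] → s = s')
    (h₃ : ∀ t, ∃ s, t ∈ (k s).flat []) : (e.bind k).Full := by
  refine ⟨?_, fun t => ?_⟩
  · rw [flat_bind, List.nodup_flatMap]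
    refine ⟨fun s _ => h₁ s, he.1.imp fun {s s'} hs => ?_⟩
    rw [Function.onFun, List.disjoint_left]
    exact fun t ht ht' => hs (h₂ s s' t ht ht')
  · obtain ⟨s, hs⟩ := h₃ t
    rw [flat_bind, List.mem_flatMap]
    exact ⟨s, he.2 s, hs⟩

theorem Full.bindEquiv {e : Word S} (he : e.Full) (σ : S ≃ T) :
    (e.bind fun s => of (σ s)).Full :=
  he.bind (fun s => by simp [flat])
    (fun s s' t h h' => σ.injective ((List.mem_singleton.1 h).symm.trans (List.mem_singleton.1 h')))
    (fun t => ⟨σ.symm t, by simp [flat]⟩)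

variable (S) in
/-- A chosen ordering of a finite set, as a right-bracketed product of its elements. -/
noncomputable def std [Finite S] : Word S :=
  letI := Fintype.ofFinite S
  ofList (Finset.univ : Finset S).toList

variable (S) in
theorem std_full [Finite S] : (std S).Full := by
  let _ := Fintype.ofFinite S
  refine ⟨?_, fun s => ?_⟩ <;> rw [std, flat_ofList]
  · exact Finset.nodup_toList _
  · simp

/-- The coherence morphism between two bracketed and ordered products of the same factors. -/
noncomputable def canon (X : S → C) (e e' : Word S) (h : (e.flat []).Perm (e'.flat [])) :
    e.ev X ⟶ e'.ev X :=
  (Classical.choice (FHom.exists_of_perm h)).interp X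

theorem Rep.canon {X : S → C} {Y : T → C} {k : S → Word T} {φ : ∀ s, X s ⟶ (k s).ev Y}
    {e : Word S} {e' e'' : Word T} {m : e.ev X ⟶ e'.ev Y} (hm : Rep k φ m)
    (h : (e'.flat []).Perm (e''.flat [])) : Rep k φ (m ≫ Word.canon Y e' e'' h) := by
  obtain ⟨f, rfl⟩ := hm
  exact ⟨f.comp (Classical.choice (FHom.exists_of_perm h)), by
    simp only [FHom.interp, Word.canon, Category.assoc]⟩

theorem Rep.evBind {X : S → C} {Y : T → C} (k : S → Word T) (φ : ∀ s, X s ⟶ (k s).ev Y)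
    (e : Word S) : Rep k φ (evBind k φ e) :=
  ⟨.id _, (Category.comp_id _).symm⟩

theorem canon_isIso (X : S → C) (e e' : Word S) (h : (e.flat []).Perm (e'.flat []))
    (he : (e.flat []).Nodup) : IsIso (canon X e e' h) := by
  refine ⟨canon X e' e h.symm, ?_, ?_⟩
  · exact FHom.coherence X he (FHom.comp (Classical.choice (FHom.exists_of_perm h))
      (Classical.choice (FHom.exists_of_perm h.symm))) (.id _)
  · exact FHom.coherence X (h.nodup_iff.1 he)
      (FHom.comp (Classical.choice (FHom.exists_of_perm h.symm))
      (Classical.choice (FHom.exists_of_perm h))) (.id _)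

end Word

open Word

section Tens

variable {S T U V : Type} [Finite S] [Finite T] {C : Type u} [Category.{v} C] [MonoidalCategory C]

/-- The tensor product `⨂_{s ∈ S} X s` of a family indexed by a finite set. It is formed with a
chosen ordering of `S`; any two orderings are canonically identified through the symmetry. -/
noncomputable def tens (X : S → C) : C := (std S).ev X

variable [SymmetricCategory C]

/-- The morphism `⨂_{s ∈ S} X s ⟶ ⨂_{t ∈ T} Y t` given by a bijection `σ : S ≃ T` and morphisms
`X s ⟶ Y (σ s)`; it permutes the factors through the symmetry. -/
noncomputable def tensMap {X : S → C} {Y : T → C} (σ : S ≃ T) (φ : ∀ s, X s ⟶ Y (σ s)) :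
    tens X ⟶ tens Y :=
  evBind (X := X) (Y := Y) (fun s => of (σ s)) φ (std S) ≫
    canon Y _ _ (((std_full S).bindEquiv σ).perm (std_full T))

theorem tensMap_rep {X : S → C} {Y : T → C} (σ : S ≃ T) (φ : ∀ s, X s ⟶ Y (σ s)) :
    Rep (X := X) (Y := Y) (fun s => of (σ s)) φ (e := std S) (e' := std T) (tensMap σ φ) :=
  (Rep.evBind _ _ _).canon _

theorem tensMap_id (X : S → C) : tensMap (Equiv.refl S) (fun s => 𝟙 (X s)) = 𝟙 (tens X) :=
  (tensMap_rep _ _).unique (Rep.ofFHom X (.id _)) (std_full S).1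

theorem tensMap_comp [Finite U] {X : S → C} {Y : T → C} {Z : U → C} (σ : S ≃ T) (τ : T ≃ U)
    (φ : ∀ s, X s ⟶ Y (σ s)) (ψ : ∀ t, Y t ⟶ Z (τ t)) :
    tensMap (σ.trans τ) (fun s => φ s ≫ ψ (σ s)) = tensMap σ φ ≫ tensMap τ ψ :=
  (tensMap_rep (σ.trans τ) _).unique ((tensMap_rep σ φ).comp (tensMap_rep τ ψ)) (std_full U).1

theorem tensMap_evBind {X : S → C} {Y : T → C} {Z : U → C} {W : V → C} (σ : S ≃ T)
    (p : ∀ s, X s ⟶ Y (σ s)) (k₁ : S → Word U) (φ₁ : ∀ s, X s ⟶ (k₁ s).ev Z)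
    (k₂ : T → Word V) (φ₂ : ∀ t, Y t ⟶ (k₂ t).ev W) (k₃ : U → Word V)
    (φ₃ : ∀ u, Z u ⟶ (k₃ u).ev W)
    (H : ∀ s, ∃ h : FHom ((k₁ s).bind k₃) (k₂ (σ s)),
      p s ≫ φ₂ (σ s) = (φ₁ s ≫ evBind k₃ φ₃ (k₁ s)) ≫ h.interp W) :
    ∃ h : FHom (((std S).bind k₁).bind k₃) ((std T).bind k₂),
      tensMap σ p ≫ evBind k₂ φ₂ (std T) =
        (evBind k₁ φ₁ (std S) ≫ evBind k₃ φ₃ ((std S).bind k₁)) ≫ h.interp W := by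
  obtain ⟨f, hf⟩ := ((tensMap_rep σ p).comp (Rep.evBind k₂ φ₂ (std T))).congr H
  obtain ⟨g, hg⟩ := evBind_evBind k₁ φ₁ k₃ φ₃ (std S)
  obtain ⟨g', hg'⟩ := g.exists_inv W
  refine ⟨g'.comp f, hf.trans ?_⟩
  rw [hg]
  simp only [FHom.interp, Category.assoc]
  rw [reassoc_of% hg']

section Merge

variable {P : S → C} {R : S → Type} [∀ s, Finite (R s)] {Q : ∀ s, R s → C}

variable (P Q) in
/-- The factors of `(⨂_s P s) ⊗ ⨂_{(s, r)} Q s r`, as one family. -/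
def mergeFam : S ⊕ (Σ s, R s) → C
  | .inl s => P s
  | .inr x => Q x.1 x.2

variable (S R) in
/-- The formal product `P_s ⊗ ⨂_r Q_{s, r}`. -/
noncomputable def mergeTgt (s : S) : Word (S ⊕ (Σ s, R s)) :=
  mul (of (.inl s)) ((std (R s)).bind fun r => of (.inr ⟨s, r⟩))

variable (S R) in
/-- The formal product `(⨂_s P_s) ⊗ ⨂_{(s, r)} Q_{s, r}`. -/
noncomputable def mergeSrc : Word (S ⊕ (Σ s, R s)) :=
  mul ((std S).bind fun s => of (.inl s)) ((std (Σ s, R s)).bind fun x => of (.inr x))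

theorem flat_bind_of {S T : Type} (ι : S → T) (e : Word S) :
    (e.bind fun s => of (ι s)).flat [] = (e.flat []).map ι := by
  rw [flat_bind]
  exact List.flatMap_pure_eq_map ι _

variable (S R) in
theorem mergeSrc_full : (mergeSrc S R).Full := by
  have h : (mergeSrc S R).flat [] =
      ((std S).flat []).map .inl ++ ((std (Σ s, R s)).flat []).map .inr := by
    rw [mergeSrc, flat, flat_append, flat_bind_of, flat_bind_of]
  refine ⟨h ▸ List.nodup_append.2 ⟨(std_full S).1.map Sum.inl_injective,
    (std_full _).1.map Sum.inr_injective, by simp⟩, fun s => ?_⟩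
  rw [h]
  rcases s with s | s
  · simpa using (std_full S).2 s
  · simpa using (std_full _).2 s

variable (S R) in
theorem mergeTgt_full : ((std S).bind (mergeTgt S R)).Full := by
  have h : ∀ s, (mergeTgt S R s).flat [] =
      .inl s :: ((std (R s)).flat []).map (fun r => .inr ⟨s, r⟩) := fun s => by
    rw [mergeTgt, flat, flat, flat_bind_of]
  refine (std_full S).bind (fun s => ?_) (fun s s' t ht ht' => ?_) (fun t => ?_)
  · rw [h, List.nodup_cons]
    exact ⟨by simp, (std_full _).1.map fun a b hab => by simpa using hab⟩
  · rw [h] at ht ht'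
    rcases t with t | t
    · simp at ht ht'
      exact ht.symm.trans ht'
    · simp at ht ht'
      obtain ⟨r, -, rfl⟩ := ht
      obtain ⟨r', -, hr⟩ := ht'
      exact (Sigma.mk.inj hr).1.symm
  · rcases t with s | ⟨s, r⟩
    · exact ⟨s, by rw [h]; simp⟩
    · exact ⟨s, by rw [h]; simpa using (std_full _).2 r⟩

/-- The identification of `⨂_s Z (ι s)` with a product of factors from the family `Z`. -/
noncomputable def incl (Z : U → C) (ι : S → U) :
    tens (fun s => Z (ι s)) ⟶ ((std S).bind fun s => of (ι s)).ev Z :=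
  evBind (X := fun s => Z (ι s)) (fun s => of (ι s)) (fun s => 𝟙 (Z (ι s))) (std S)

instance incl_isIso (Z : U → C) (ι : S → U) : IsIso (incl Z ι) :=
  have : ∀ s, IsIso (X := Z (ι s)) (Y := (of (ι s)).ev Z) (𝟙 (Z (ι s))) := fun s =>
    inferInstanceAs (IsIso (𝟙 (Z (ι s))))
  evBind_isIso (X := fun s => Z (ι s)) (fun s => of (ι s)) (fun s => 𝟙 (Z (ι s))) (std S)

variable (P Q) in
/-- Identification with a formal product. -/
noncomputable def splitSrc : tens P ⊗ tens (fun x : Σ s, R s => Q x.1 x.2) ⟶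
    (mergeSrc S R).ev (mergeFam P Q) :=
  incl (mergeFam P Q) .inl ⊗ₘ incl (mergeFam P Q) .inr

variable (P Q) in
/-- Identification with a formal product. -/
noncomputable def splitFib (s : S) : P s ⊗ tens (Q s) ⟶ (mergeTgt S R s).ev (mergeFam P Q) :=
  𝟙 (P s) ⊗ₘ incl (mergeFam P Q) (fun r => .inr ⟨s, r⟩)

instance splitFib_isIso (s : S) : IsIso (splitFib P Q s) :=
  inferInstanceAs (IsIso (𝟙 (P s) ⊗ₘ incl (mergeFam P Q) (fun r => .inr ⟨s, r⟩)))

variable (P Q) in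
/-- Identification with a formal product. -/
noncomputable def splitTgt : tens (fun s => P s ⊗ tens (Q s)) ⟶
    ((std S).bind (mergeTgt S R)).ev (mergeFam P Q) :=
  evBind (mergeTgt S R) (splitFib P Q) (std S)

instance splitTgt_isIso : IsIso (splitTgt P Q) :=
  evBind_isIso (mergeTgt S R) (splitFib P Q) (std S)

variable (P Q) in
/-- The coherence isomorphism `(⨂_s P_s) ⊗ ⨂_{(s, r)} Q_{s, r} ≅ ⨂_s (P_s ⊗ ⨂_r Q_{s, r})`. -/
noncomputable def merge : tens P ⊗ tens (fun x : Σ s, R s => Q x.1 x.2) ⟶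
    tens (fun s => P s ⊗ tens (Q s)) :=
  splitSrc P Q ≫
    canon (mergeFam P Q) _ _ ((mergeSrc_full S R).perm (mergeTgt_full S R)) ≫
    inv (splitTgt P Q)

theorem tensMap_incl {U V : Type} {Z : U → C} {W : V → C} (ι : S → U) (κ : T → V) (σ : S ≃ T)
    (Φ : U → V) (z : ∀ u, Z u ⟶ W (Φ u)) (p : ∀ s, Z (ι s) ⟶ W (κ (σ s)))
    (H : ∀ s, ∃ f : FHom (of (Φ (ι s))) (of (κ (σ s))), p s = z (ι s) ≫ f.interp W) :
    ∃ h : FHom (((std S).bind fun s => of (ι s)).bind fun u => of (Φ u))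
        ((std T).bind fun t => of (κ t)),
      tensMap (X := fun s => Z (ι s)) (Y := fun t => W (κ t)) σ p ≫ incl W κ =
        (incl Z ι ≫ evBind (X := Z) (Y := W) (fun u => of (Φ u)) z _) ≫ h.interp W := by
  refine tensMap_evBind (X := fun s => Z (ι s)) (Y := fun t => W (κ t)) (Z := Z) (W := W) σ p _ _
    _ _ _ _ fun s => ?_
  obtain ⟨f, hf⟩ := H s
  exact ⟨f, ((Category.comp_id _).trans hf).trans (congr_arg (· ≫ _) (Category.id_comp _).symm)⟩

theorem fib_aux {P₀ P₁ T₀ T₁ U₀ U₁ V₁ : C} (p : P₀ ⟶ P₁) (t : T₀ ⟶ T₁) (i' : T₁ ⟶ V₁)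
    (i : T₀ ⟶ U₀) (e : U₀ ⟶ U₁) (f : U₁ ⟶ V₁) (h : t ≫ i' = (i ≫ e) ≫ f) :
    (p ⊗ₘ t) ≫ (𝟙 P₁ ⊗ₘ i') = ((𝟙 P₀ ⊗ₘ i) ≫ (p ⊗ₘ e)) ≫ (𝟙 P₁ ⊗ₘ f) := by
  rw [tensorHom_comp_tensorHom, h]
  simp only [tensorHom_comp_tensorHom, Category.comp_id, Category.id_comp]

theorem src_aux {A A' B B' E E' F F' V V' : C} (a : A ⟶ A') (b : B ⟶ B') (i' : A' ⟶ V)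
    (j' : B' ⟶ V') (i : A ⟶ E) (j : B ⟶ E') (e : E ⟶ F) (e' : E' ⟶ F') (f : F ⟶ V)
    (f' : F' ⟶ V') (h : a ≫ i' = (i ≫ e) ≫ f) (h' : b ≫ j' = (j ≫ e') ≫ f') :
    (a ⊗ₘ b) ≫ (i' ⊗ₘ j') = ((i ⊗ₘ j) ≫ (e ⊗ₘ e')) ≫ (f ⊗ₘ f') := by
  simp only [tensorHom_comp_tensorHom, h, h']

theorem square_aux {A A' B B' D D' E F G K : C} (ab : A ⟶ A') (s' : A' ⟶ B') (s : A ⟶ B)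
    (e : B ⟶ E) (fg : E ⟶ B') (c : B ⟶ D) (n : D ⟶ F) (cb : E ⟶ F) (t : G ⟶ K)
    (g' : K ⟶ D') (g : G ⟶ D) (h : F ⟶ D') (c' : B' ⟶ D') [IsIso g] [IsIso g']
    (h₁ : ab ≫ s' = (s ≫ e) ≫ fg) (h₂ : c ≫ n = e ≫ cb) (h₃ : t ≫ g' = (g ≫ n) ≫ h)
    (h₄ : fg ≫ c' = cb ≫ h) :
    ab ≫ (s' ≫ c' ≫ inv g') = (s ≫ c ≫ inv g) ≫ t := by
  rw [← cancel_mono g']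
  simp only [Category.assoc, IsIso.inv_hom_id, Category.comp_id, h₃, IsIso.inv_hom_id_assoc]
  rw [reassoc_of% h₁, h₄, reassoc_of% h₂]

theorem merge_natural {P' : T → C} {R' : T → Type} [∀ s, Finite (R' s)] {Q' : ∀ s, R' s → C}
    (σ : S ≃ T) (τ : ∀ s, R s ≃ R' (σ s)) (p : ∀ s, P s ⟶ P' (σ s))
    (q : ∀ s r, Q s r ⟶ Q' (σ s) (τ s r)) :
    (tensMap σ p ⊗ₘ tensMap (X := fun x : Σ s, R s => Q x.1 x.2)
      (Y := fun x : Σ s, R' s => Q' x.1 x.2) (σ.sigmaCongr τ) (fun x => q x.1 x.2)) ≫ merge P' Q' =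
    merge P Q ≫ tensMap (X := fun s => P s ⊗ tens (Q s)) (Y := fun s => P' s ⊗ tens (Q' s)) σ
      (fun s => p s ⊗ₘ tensMap (τ s) (q s)) := by
  let Φ : S ⊕ (Σ s, R s) → T ⊕ (Σ s, R' s)
    | .inl s => .inl (σ s)
    | .inr x => .inr ⟨σ x.1, τ x.1 x.2⟩
  let z : ∀ u, mergeFam P Q u ⟶ mergeFam P' Q' (Φ u)
    | .inl s => p s
    | .inr x => q x.1 x.2
  -- the fibrewise comparison
  obtain ⟨h, hh⟩ := tensMap_evBind (X := fun s => P s ⊗ tens (Q s))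
    (Y := fun s => P' s ⊗ tens (Q' s)) (W := mergeFam P' Q') σ
    (fun s => p s ⊗ₘ tensMap (τ s) (q s)) (mergeTgt S R) (splitFib P Q) (mergeTgt T R')
    (splitFib P' Q') (fun u => of (Φ u)) z fun s => by
      obtain ⟨f, hf⟩ := tensMap_incl (Z := mergeFam P Q) (W := mergeFam P' Q')
        (fun r : R s => .inr ⟨s, r⟩) (fun r : R' (σ s) => .inr ⟨σ s, r⟩) (τ s) Φ z (q s)
        (fun r => ⟨.id _, (Category.comp_id _).symm⟩)
      refine ⟨.tensor (.id _) f, ?_⟩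
      exact fib_aux _ _ _ _ _ _ hf
  obtain ⟨f, hf⟩ := tensMap_incl (Z := mergeFam P Q) (W := mergeFam P' Q')
    Sum.inl Sum.inl σ Φ z p (fun r => ⟨.id _, (Category.comp_id _).symm⟩)
  obtain ⟨g, hg⟩ := tensMap_incl (Z := mergeFam P Q) (W := mergeFam P' Q')
    Sum.inr Sum.inr (σ.sigmaCongr τ) Φ z (fun x => q x.1 x.2)
      (fun r => ⟨.id _, (Category.comp_id _).symm⟩)
  exact square_aux _ (splitSrc P' Q') (splitSrc P Q)
    (evBind (X := mergeFam P Q) (Y := mergeFam P' Q') (fun u => of (Φ u)) z (mergeSrc S R))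
    ((FHom.tensor f g).interp (mergeFam P' Q')) _
    (evBind (X := mergeFam P Q) (Y := mergeFam P' Q') (fun u => of (Φ u)) z _) _ _
    (splitTgt P' Q') (splitTgt P Q) (h.interp (mergeFam P' Q')) _
    (src_aux _ _ _ _ _ _ _ _ _ _ hf hg) (interp_evBind _ _ _) hh
    (FHom.coherence (mergeFam P' Q') (mergeTgt_full T R').1
      (.comp (.tensor f g) (Classical.choice
        (FHom.exists_of_perm ((mergeSrc_full T R').perm (mergeTgt_full T R')))))
      (.comp (FHom.bind (fun u => of (Φ u)) (Classical.choice
        (FHom.exists_of_perm ((mergeSrc_full S R).perm (mergeTgt_full S R))))) h))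

end Merge

/-- The coherence isomorphism `⨂_{s ∈ S} 1 ≅ 1`. -/
noncomputable def tensUnit (S : Type) [Finite S] : tens (fun _ : S => 𝟙_ C) ⟶ 𝟙_ C :=
  evBind (X := fun _ : S => 𝟙_ C) (Y := fun x : PEmpty => x.elim) (fun _ => one)
      (fun _ => 𝟙 (𝟙_ C)) (std S) ≫
    canon (fun x : PEmpty => x.elim) _ one (by
      rw [flat_bind]; simp [flat])

/-- The coherence isomorphism `⨂_{s ∈ {⋆}} X ≅ X`. -/
noncomputable def tensPoint (X : C) : tens (fun _ : PUnit => X) ⟶ X :=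
  canon (fun _ : PUnit => X) (std PUnit) (of PUnit.unit)
    ((std_full PUnit).perm ⟨by simp [flat], fun s => by simp [flat]⟩)

theorem tensPoint_natural {X Y : C} (f : X ⟶ Y) :
    tensMap (X := fun _ : PUnit => X) (Y := fun _ : PUnit => Y) (Equiv.refl PUnit) (fun _ => f) ≫
      tensPoint Y = tensPoint X ≫ f := by
  have h := (Rep.ofFHom (fun _ : PUnit => X) (Classical.choice (FHom.exists_of_perm
    ((std_full PUnit).perm (e' := of PUnit.unit) ⟨by simp [flat], fun s => by simp [flat]⟩)))).comp
    (Rep.evBind (X := fun _ : PUnit => X) (Y := fun _ : PUnit => Y) (fun s => of s) (fun _ => f)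
      (of PUnit.unit))
  refine Rep.unique (X := fun _ : PUnit => X) (Y := fun _ : PUnit => Y) (e := std PUnit)
    (e' := of PUnit.unit) (k := fun s => of s) (φ := fun _ => f)
    ((tensMap_rep (X := fun _ : PUnit => X) (Y := fun _ : PUnit => Y) (Equiv.refl PUnit)
      (fun _ => f)).canon _)
    (h.congr' fun s => (Category.id_comp _)) (by simp [flat])

end Tens

/-! ## Finite sets and wreath products -/

/-- Finite sets, the objects of the category `Σ_*` of finite sets and bijections. -/
structure FinBij where
  carrier : Type
  [finite : Finite carrier]

attribute [instance] FinBij.finite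

instance : Category.{0} FinBij where
  Hom S T := S.carrier ≃ T.carrier
  id S := Equiv.refl _
  comp f g := f.trans g

/-- A bijection as a morphism of `Σ_*`. -/
def FinBij.homOf {S T : FinBij} (e : S.carrier ≃ T.carrier) : S ⟶ T := e

/-- Objects of the wreath product category `Σ_* ≀ A`: finite families `{A_s}_{s ∈ S}` of objects
of `A`. -/
structure Wreath (A : Type u) where
  base : FinBij
  fam : base.carrier → A

namespace Wreath

section
variable {A : Type u} [Category.{v} A] {B : Type*} [Category* B]

/-- Morphisms `{A_s}_{s ∈ S} ⟶ {B_t}_{t ∈ T}` of `Σ_* ≀ A`: a bijection `σ : S ≃ T` and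
morphisms `A_s ⟶ B_{σ s}`. -/
structure Hom (x y : Wreath A) where
  base : x.base.carrier ≃ y.base.carrier
  fam : ∀ s, x.fam s ⟶ y.fam (base s)

theorem Hom.mk_eq {x y : Wreath A} {b b' : x.base.carrier ≃ y.base.carrier} (h : b = b')
    (F : ∀ s, x.fam s ⟶ y.fam (b s)) (F' : ∀ s, x.fam s ⟶ y.fam (b' s))
    (hF : ∀ s, F s ≫ eqToHom (by rw [h]) = F' s) : Hom.mk b F = Hom.mk b' F' := by
  subst h
  exact congr_arg _ (funext fun s => (Category.comp_id _).symm.trans (hF s))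

instance : Category (Wreath A) where
  Hom x y := Hom x y
  id x := ⟨Equiv.refl _, fun s => 𝟙 (x.fam s)⟩
  comp f g := ⟨f.base.trans g.base, fun s => f.fam s ≫ g.fam (f.base s)⟩
  id_comp f := by
    cases f; exact congr_arg (Hom.mk _) (funext fun _ => Category.id_comp _)
  comp_id f := by
    cases f; exact congr_arg (Hom.mk _) (funext fun _ => Category.comp_id _)
  assoc f g h := congr_arg (Hom.mk _) (funext fun _ => Category.assoc _ _ _)

/-- The functor `Id ≀ G : Σ_* ≀ A ⥤ Σ_* ≀ B`. -/
def map (G : A ⥤ B) : Wreath A ⥤ Wreath B where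
  obj x := ⟨x.base, fun s => G.obj (x.fam s)⟩
  map f := ⟨f.base, fun s => G.map (f.fam s)⟩
  map_id _ := congr_arg (Hom.mk _) (funext fun _ => G.map_id _)
  map_comp _ _ := congr_arg (Hom.mk _) (funext fun _ => G.map_comp _ _)

/-- The functor `γ² ≀ Id : Σ_* ≀ Σ_* ≀ A ⥤ Σ_* ≀ A`, which composes the maps `⋆ ← S ← T` of
finite sets, and so turns a family of families into one family over the disjoint union. On trees,
it forgets the vertices at height 1. -/
def flatten (A : Type u) [Category.{v} A] : Wreath (Wreath A) ⥤ Wreath A where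
  obj x := ⟨⟨Σ s : x.base.carrier, (x.fam s).base.carrier⟩, fun p => (x.fam p.1).fam p.2⟩
  map f := ⟨f.base.sigmaCongr fun s => (f.fam s).base, fun p => (f.fam p.1).fam p.2⟩
  map_id _ := rfl
  map_comp {x _ z} f g := Hom.mk_eq
    (x := ⟨⟨Σ s : x.base.carrier, (x.fam s).base.carrier⟩, fun p => (x.fam p.1).fam p.2⟩)
    (y := ⟨⟨Σ s : z.base.carrier, (z.fam s).base.carrier⟩, fun p => (z.fam p.1).fam p.2⟩)
    (b := (f ≫ g).base.sigmaCongr fun s => ((f ≫ g).fam s).base)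
    (b' := (f.base.sigmaCongr fun s => (f.fam s).base).trans
      (g.base.sigmaCongr fun s => (g.fam s).base)) (Equiv.ext fun _ => rfl)
    (fun p => (f.fam p.1).fam p.2 ≫ (g.fam (f.base p.1)).fam ((f.fam p.1).base p.2))
    (fun p => (f.fam p.1).fam p.2 ≫ (g.fam (f.base p.1)).fam ((f.fam p.1).base p.2))
    fun _ => (congr_arg (_ ≫ ·) (eqToHom_refl _ _)).trans (Category.comp_id _)

/-- The functor `s_0 : A ⥤ Σ_* ≀ A`, sending `a` to the one-element family `{a}`. On trees, it
doubles the vertex at height 0. -/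
def point (A : Type u) [Category.{v} A] : A ⥤ Wreath A where
  obj a := ⟨⟨PUnit⟩, fun _ => a⟩
  map f := ⟨Equiv.refl _, fun _ => f⟩

/-- The functor `γ² : Σ_* ≀ Σ_* ⥤ Σ_*`, `{S_t}_{t ∈ T} ↦ ∐_t S_t`. -/
def total : Wreath FinBij ⥤ FinBij where
  obj x := ⟨Σ s : x.base.carrier, (x.fam s).carrier⟩
  map f := f.base.sigmaCongr fun s => f.fam s
  map_id _ := rfl
  map_comp _ _ := Equiv.ext fun _ => rfl

end
theorem isIso_mk {A : Type u} [Category.{v} A] {x y : Wreath A} (b : x.base.carrier ≃ y.base.carrier)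
    (φ : ∀ s, x.fam s ⟶ y.fam (b s)) [∀ s, IsIso (φ s)] :
    Nonempty (x ≅ y) := by
  refine ⟨⟨⟨b, φ⟩, ⟨b.symm, fun t => eqToHom (by simp) ≫ inv (φ (b.symm t))⟩, ?_, ?_⟩⟩
  · refine Hom.mk_eq (b := b.trans b.symm) (b' := Equiv.refl _) (by simp) _ _ fun s => ?_
    have : ∀ s' (h : s' = s), (φ s ≫ eqToHom (by rw [h]) ≫ inv (φ s')) ≫
        eqToHom (by rw [h]) = 𝟙 (x.fam s) := by
      rintro s' rfl; simp
    exact this _ (b.symm_apply_apply s)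
  · refine Hom.mk_eq (b := b.symm.trans b) (b' := Equiv.refl _) (by simp) _ _ fun t => ?_
    simp
    exact eqToHom_trans _ _

instance essentiallySmall (A : Type 1) [Category.{0} A] [EssentiallySmall.{0} A] :
    EssentiallySmall.{0} (Wreath A) := by
  rw [essentiallySmall_iff]
  refine ⟨?_, inferInstance⟩
  have : Small.{0} (Skeleton A) := ((essentiallySmall_iff A).1 inferInstance).1
  refine small_of_surjective (α := Σ n : ℕ, Fin n → Skeleton A)
    (f := fun p => toSkeleton ⟨⟨Fin p.1⟩, fun i => (fromSkeleton A).obj (p.2 i)⟩) fun x => ?_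
  obtain ⟨y, rfl⟩ : ∃ y, toSkeleton y = x := ⟨_, Quotient.out_eq x⟩
  obtain ⟨n, ⟨e⟩⟩ := Finite.exists_equiv_fin y.base.carrier
  refine ⟨⟨n, fun i => toSkeleton (y.fam (e.symm i))⟩, ?_⟩
  exact congr_toSkeleton_of_iso <| Classical.choice <| isIso_mk (x := ⟨⟨Fin n⟩, fun i => (fromSkeleton A).obj (toSkeleton (y.fam (e.symm i)))⟩)
    (y := y) e.symm fun i => (fromSkeletonToSkeletonIso (y.fam (e.symm i))).hom

end Wreath

section Circ

variable {C : Type u} [Category.{v} C] [MonoidalCategory C] [SymmetricCategory C]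
  {W : Type*} [Category* W]

/-- The functor `O ⊚ F : Σ_* ≀ W ⥤ C`, `{w_s}_{s ∈ S} ↦ O(S) ⊗ ⨂_{s ∈ S} F(w_s)`. -/
noncomputable def circ (O : FinBij ⥤ C) (F : W ⥤ C) : Wreath W ⥤ C where
  obj x := O.obj x.base ⊗ tens fun s => F.obj (x.fam s)
  map {x y} f := O.map (X := x.base) (Y := y.base) f.base ⊗ₘ
    tensMap f.base fun s => F.map (f.fam s)
  map_id x := by
    refine (congr_arg₂ (fun a b => a ⊗ₘ b) (O.map_id x.base) ?_).trans (id_tensorHom_id _ _)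
    refine Eq.trans ?_ (tensMap_id fun s => F.obj (x.fam s))
    exact congr_arg (tensMap (Equiv.refl _)) (funext fun s => F.map_id _)
  map_comp {x y z} f g := by
    refine (congr_arg₂ (fun a b => a ⊗ₘ b)
      (O.map_comp (X := x.base) (Y := y.base) (Z := z.base) f.base g.base) ?_).trans
      (tensorHom_comp_tensorHom _ _ _ _).symm
    refine Eq.trans ?_ (tensMap_comp (X := fun s => F.obj (x.fam s))
      (Y := fun s => F.obj (y.fam s)) (Z := fun s => F.obj (z.fam s)) f.base g.base
      (fun s => F.map (f.fam s)) (fun s => F.map (g.fam s)))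
    exact congr_arg (tensMap (f.base.trans g.base)) (funext fun s => F.map_comp _ _)

/-- The natural transformation `Id ⊚ θ : O ⊚ F ⟶ O ⊚ G`. -/
noncomputable def circMap (O : FinBij ⥤ C) {F G : W ⥤ C} (θ : F ⟶ G) : circ O F ⟶ circ O G where
  app x := O.obj x.base ◁ tensMap (Equiv.refl _) fun s => θ.app (x.fam s)
  naturality x y f := by
    have h : tensMap (X := fun s => F.obj (x.fam s)) (Y := fun s => F.obj (y.fam s)) f.base
          (fun s => F.map (f.fam s)) ≫
        tensMap (Y := fun s => G.obj (y.fam s)) (Equiv.refl _) (fun s => θ.app (y.fam s)) =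
        tensMap (Y := fun s => G.obj (x.fam s)) (Equiv.refl _) (fun s => θ.app (x.fam s)) ≫
          tensMap (X := fun s => G.obj (x.fam s)) (Y := fun s => G.obj (y.fam s)) f.base
            (fun s => G.map (f.fam s)) := by
      refine (tensMap_comp (X := fun s => F.obj (x.fam s)) (Y := fun s => F.obj (y.fam s))
        (Z := fun s => G.obj (y.fam s)) f.base (Equiv.refl _) (fun s => F.map (f.fam s))
        (fun s => θ.app (y.fam s))).symm.trans (Eq.trans ?_
          (tensMap_comp (X := fun s => F.obj (x.fam s)) (Y := fun s => G.obj (x.fam s))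
            (Z := fun s => G.obj (y.fam s)) (Equiv.refl _) f.base (fun s => θ.app (x.fam s))
            (fun s => G.map (f.fam s))))
      exact congr_arg (tensMap f.base) (funext fun s => θ.naturality _)
    have h' : ∀ {a b c d : C} (i : O.obj x.base ⟶ O.obj y.base) (p : a ⟶ b) (q : b ⟶ c) (p' : a ⟶ d) (q' : d ⟶ c),
        p ≫ q = p' ≫ q' → (i ⊗ₘ p) ≫ (O.obj y.base ◁ q) = (O.obj x.base ◁ p') ≫ (i ⊗ₘ q') := by
      intro a b c d i p q p' q' h
      simp only [← id_tensorHom, tensorHom_comp_tensorHom, h, Category.id_comp, Category.comp_id]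
    exact h' _ _ _ _ _ h

/-- The natural transformation `(O ⊚ F) (γ² ≀ Id) ⟶ (O ⊚ O) ⊚ F ≅ O ⊚ (O ⊚ F)` induced by a
natural transformation `Δ : O γ² ⟶ O ⊚ O`. -/
noncomputable def cocompWreath {O : FinBij ⥤ C} (Δ : Wreath.total ⋙ O ⟶ circ O O) (F : W ⥤ C) :
    Wreath.flatten W ⋙ circ O F ⟶ circ O (circ O F) where
  app x :=
    (Δ.app ⟨x.base, fun s => (x.fam s).base⟩ ⊗ₘ 𝟙 (tens fun p : Σ s, (x.fam s).base.carrier => F.obj ((x.fam p.1).fam p.2))) ≫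
      (α_ _ _ _).hom ≫
      (O.obj x.base ◁ merge (fun s => O.obj (x.fam s).base)
        (fun s r => F.obj ((x.fam s).fam r)))
  naturality x y f := by
    have h' : ∀ {a a' b b' p p' q q' m m' : C} (i : a ⟶ a') (d : a ⟶ p ⊗ q) (d' : a' ⟶ p' ⊗ q') (j : p ⟶ p') (k : q ⟶ q') (t : b ⟶ b')
       (μ : q ⊗ b ⟶ m) (μ' : q' ⊗ b' ⟶ m') (l : m ⟶ m'), i ≫ d' = d ≫ (j ⊗ₘ k) → (k ⊗ₘ t) ≫ μ' = μ ≫ l →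
       (i ⊗ₘ t) ≫ ((d' ⊗ₘ 𝟙 b') ≫ (α_ _ _ _).hom ≫ (p' ◁ μ')) = ((d ⊗ₘ 𝟙 b) ≫ (α_ _ _ _).hom ≫ (p ◁ μ)) ≫ (j ⊗ₘ l) := by
      intro a a' b b' p p' q q' m m' i d d' j k t μ μ' l h₁ h₂
      simp only [tensorHom_comp_tensorHom_assoc, h₁, Category.comp_id, Category.assoc]
      have : (d ≫ (j ⊗ₘ k)) ⊗ₘ t = (d ⊗ₘ 𝟙 b) ≫ ((j ⊗ₘ k) ⊗ₘ t) := by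
        rw [tensorHom_comp_tensorHom, Category.id_comp]
      rw [this, Category.assoc, associator_naturality_assoc]
      simp only [← id_tensorHom, tensorHom_comp_tensorHom, h₂, Category.id_comp, Category.comp_id]
    exact h' _ _ _ _ _ _ _ _ _ (Δ.naturality (X := ⟨x.base, fun s => (x.fam s).base⟩)
      (Y := ⟨y.base, fun s => (y.fam s).base⟩) ⟨f.base, fun s => (f.fam s).base⟩)
      (merge_natural (P := fun s => O.obj (x.fam s).base) (P' := fun s => O.obj (y.fam s).base)
        (Q := fun s r => F.obj ((x.fam s).fam r)) (Q' := fun s r => F.obj ((y.fam s).fam r)) f.base (fun s => (f.fam s).base)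
        (fun s => O.map (X := (x.fam s).base) (Y := (y.fam (f.base s)).base) (f.fam s).base)
        (fun s r => F.map ((f.fam s).fam r)))

section Counit

variable [HasTerminal C]

variable (C) in
open Classical in
/-- The counit symmetric sequence: the unit object in arity one, the final object elsewhere. -/
noncomputable def unitSeq : FinBij ⥤ C where
  obj S := if Nat.card S.carrier = 1 then 𝟙_ C else ⊤_ C
  map f := eqToHom (by rw [Nat.card_congr f])
  map_id _ := rfl
  map_comp _ _ := (eqToHom_trans _ _).symm

/-- The morphism `O(⋆) ⟶ 1` given by `ε : O ⟶ unitSeq C`. -/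
noncomputable def counitPt {O : FinBij ⥤ C} (ε : O ⟶ unitSeq C) : O.obj ⟨PUnit⟩ ⟶ 𝟙_ C :=
  ε.app ⟨PUnit⟩ ≫ eqToHom (if_pos Nat.card_unique)

/-- The natural transformation `(O ⊚ F) s_0 ⟶ (unitSeq ⊚ F) s_0 ≅ F` induced by `ε`. -/
noncomputable def counitPoint {O : FinBij ⥤ C} (ε : O ⟶ unitSeq C) (F : W ⥤ C) :
    Wreath.point W ⋙ circ O F ⟶ F where
  app w := (counitPt ε ⊗ₘ tensPoint (F.obj w)) ≫ (λ_ (F.obj w)).hom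
  naturality w w' f := by
    have h' : ∀ {o a a' b b' : C} (i : o ⟶ o) (e : o ⟶ 𝟙_ C) (t : a ⟶ a') (p : a ⟶ b) (p' : a' ⟶ b') (g : b ⟶ b'),
      i = 𝟙 _ → t ≫ p' = p ≫ g → (i ⊗ₘ t) ≫ ((e ⊗ₘ p') ≫ (λ_ b').hom) = ((e ⊗ₘ p) ≫ (λ_ b).hom) ≫ g := by
      rintro o a a' b b' i e t p p' g rfl h
      simp only [tensorHom_comp_tensorHom_assoc, h, Category.assoc, Category.id_comp]
      simp [MonoidalCategory.tensorHom_def]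
    exact h' _ _ _ _ _ _ (O.map_id _) (tensPoint_natural (F.map f))

variable (C) in
/-- A counital cooperad: a symmetric sequence with a cocomposition and a counit.
* `coassoc`: the two composites `O γ³ ⟶ O ⊚ O ⊚ O`, through `(O ⊚ O) (γ² ≀ Id)` and through
  `(O ⊚ O) (Id ≀ γ²)`, agree; here `γ² (γ² ≀ Id)` and `γ² (Id ≀ γ²)` are identified through the
  bijection `∐_{(s, t)} U_{s, t} ≃ ∐_s ∐_t U_{s, t}`.
* `counit_left`: `O = O γ² s_0 ⟶ (O ⊚ O) s_0 ⟶ (unitSeq ⊚ O) s_0 = O` is the identity.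
* `counit_right`: `O = O γ² s_1 ⟶ (O ⊚ O) s_1 ⟶ (O ⊚ unitSeq) s_1 = O` is the identity, where
  `s_1 : Σ_* ⥤ Σ_* ≀ Σ_*` sends `S` to the family `{⋆}_{s ∈ S}`. -/
structure Cooperad where
  /-- the symmetric sequence -/
  obj : FinBij ⥤ C
  /-- the cocomposition -/
  cocomp : Wreath.total ⋙ obj ⟶ circ obj obj
  /-- the counit -/
  counit : obj ⟶ unitSeq C
  coassoc : ∀ x : Wreath (Wreath FinBij),
    cocomp.app ((Wreath.flatten FinBij).obj x) ≫ (cocompWreath cocomp obj).app x =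
      obj.map (X := Wreath.total.obj ((Wreath.flatten FinBij).obj x))
          (Y := Wreath.total.obj ((Wreath.map Wreath.total).obj x))
          (FinBij.homOf (Equiv.sigmaAssoc fun s t => ((x.fam s).fam t).carrier)) ≫
        cocomp.app ((Wreath.map Wreath.total).obj x) ≫ (circMap obj cocomp).app x
  counit_left : ∀ S : FinBij,
    obj.map (Y := Wreath.total.obj ((Wreath.point FinBij).obj S))
        (FinBij.homOf (Equiv.uniqueSigma fun _ : PUnit => S.carrier).symm) ≫
      cocomp.app ((Wreath.point FinBij).obj S) ≫ (counitPoint counit obj).app S = 𝟙 (obj.obj S)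
  counit_right : ∀ S : FinBij,
    obj.map (Y := Wreath.total.obj ⟨S, fun _ => ⟨PUnit⟩⟩)
        (FinBij.homOf (Equiv.sigmaPUnit S.carrier).symm) ≫
      cocomp.app ⟨S, fun _ => ⟨PUnit⟩⟩ ≫
      (obj.obj S ◁ (tensMap (Equiv.refl _) (fun _ => counitPt counit) ≫ tensUnit S.carrier)) ≫
      (ρ_ _).hom = 𝟙 (obj.obj S)

/-! ## Coalgebras -/

/-- The category `Σ_0` of empty sets. -/
abbrev Sigma0 := ObjectProperty.FullSubcategory fun S : FinBij => IsEmpty S.carrier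

/-- The empty set, as an object of `Σ_0`. -/
def empty : Sigma0 := ⟨⟨PEmpty⟩, inferInstance⟩

/-- A coalgebra over the cooperad `O`: an object `c` of `C`, viewed as a (constant) functor on
`Σ_0`, with a natural transformation `c γ̄² ⟶ O ⊚ c` of functors on `Σ_* ≀ Σ_0`.
* `coassoc`: the two composites `c γ̄³ ⟶ O ⊚ O ⊚ c`, through `(O ⊚ c) (γ² ≀ Id)` and through
  `(O ⊚ c) (Id ≀ γ̄²)`, agree.
* `counit`: `c = c γ̄² s_0 ⟶ (O ⊚ c) s_0 ⟶ (unitSeq ⊚ c) s_0 = c` is the identity. -/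
structure Coalgebra (O : Cooperad C) where
  /-- the underlying object -/
  obj : C
  /-- the comultiplication -/
  comul : (Functor.const (Wreath Sigma0)).obj obj ⟶ circ O.obj ((Functor.const Sigma0).obj obj)
  coassoc : ∀ x : Wreath (Wreath Sigma0),
    comul.app ((Wreath.flatten Sigma0).obj x) ≫
        (cocompWreath O.cocomp ((Functor.const Sigma0).obj obj)).app x =
      comul.app ((Wreath.map ((Functor.const (Wreath Sigma0)).obj empty)).obj x) ≫
        (circMap O.obj comul).app x
  counit : ∀ E : Sigma0,
    comul.app ((Wreath.point Sigma0).obj E) ≫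
      (counitPoint O.counit ((Functor.const Sigma0).obj obj)).app E = 𝟙 obj

/-! ## The cosimplicial complex of a coalgebra -/

/-- The category of leafless trees of level `n + 1` and their isomorphisms, equivalently of chains
`⋆ ← S_1 ← ⋯ ← S_n ← ∅` of finite sets and their isomorphisms:
`Σ_* ≀ (Σ_* ≀ ⋯ (Σ_* ≀ Σ_0))`, with `n` factors `Σ_*`. A leafless tree of level 1 is a single
vertex with an empty set of incoming edges; a leafless tree of level `n + 2` is given by the finite
set of the incoming edges of its lowest vertex and a leafless tree of level `n + 1` on each of
them. -/
def Level : ℕ → Cat.{0, 1}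
  | 0 => Cat.of Sigma0
  | n + 1 => Cat.of (Wreath (Level n))

/-- The face functor that forgets the vertices at height `i + 1`, i.e. deletes `S_{i + 1}` from
the chain `⋆ ← S_1 ← ⋯ ← S_{n + 1} ← ∅` by composing maps, for `0 ≤ i ≤ n`. -/
def face : ∀ n : ℕ, Fin (n + 1) → Level (n + 1) ⥤ Level n
  | 0, _ => (Functor.const (Wreath Sigma0)).obj empty
  | n + 1, ⟨0, _⟩ => Wreath.flatten (Level n)
  | n + 1, ⟨i + 1, h⟩ => Wreath.map (face n ⟨i, Nat.lt_of_succ_lt_succ h⟩)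

/-- The degeneracy functor that doubles the vertices at height `i`, i.e. replaces `S_i` by
`S_i ← S_i` in the chain `⋆ = S_0 ← S_1 ← ⋯ ← S_n ← ∅`, for `0 ≤ i ≤ n`. -/
def degen : ∀ n : ℕ, Fin (n + 1) → Level n ⥤ Level (n + 1)
  | 0, _ => Wreath.point Sigma0
  | n + 1, ⟨0, _⟩ => Wreath.point (Level (n + 1))
  | n + 1, ⟨i + 1, h⟩ => Wreath.map (degen n ⟨i, Nat.lt_of_succ_lt_succ h⟩)

/-- The functor `γ̄` to `Σ_0`, which forgets all vertices but the lowest one: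
`(⋆ ← S_1 ← ⋯ ← S_n ← ∅) ↦ (⋆ ← ∅)`. -/
def gam (n : ℕ) : Level n ⥤ Sigma0 := (Functor.const (Level n)).obj empty

instance essentiallySmall_sigma0 : EssentiallySmall.{0} Sigma0 := by
  rw [essentiallySmall_iff]
  refine ⟨?_, inferInstance⟩
  refine small_of_surjective (α := Unit) (f := fun _ => toSkeleton empty) fun x => ?_
  obtain ⟨y, rfl⟩ : ∃ y, toSkeleton y = x := ⟨_, Quotient.out_eq x⟩
  have := y.2
  exact ⟨(), congr_toSkeleton_of_iso (ObjectProperty.isoMk _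
    (X := empty) (Y := y)
    ⟨FinBij.homOf (S := ⟨PEmpty⟩) (T := y.1) (Equiv.equivOfIsEmpty _ _),
      FinBij.homOf (S := y.1) (T := ⟨PEmpty⟩) (Equiv.equivOfIsEmpty _ _),
      Equiv.ext fun s => PEmpty.elim s, Equiv.ext fun s => (y.2.false s).elim⟩)⟩

instance essentiallySmall_level (n : ℕ) : EssentiallySmall.{0} (Level n) := by
  induction n with
  | zero => exact essentiallySmall_sigma0
  | succ n ih => exact Wreath.essentiallySmall (Level n)

namespace Coalgebra

variable {O : Cooperad C} (c : Coalgebra O)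

/-- The functor `O ⊚ ⋯ ⊚ O ⊚ c` on leafless trees of level `n + 1`, with `n` factors `O`. -/
noncomputable def treeFunctor : ∀ n : ℕ, Level n ⥤ C
  | 0 => (Functor.const Sigma0).obj c.obj
  | n + 1 => circ O.obj (treeFunctor n)

/-- The natural transformation `(O^{⊚ n} ⊚ c) ∂_i ⟶ O^{⊚ (n + 1)} ⊚ c` that applies the
cocomposition to the `i`-th factor `O` (counted from `0`) if `i < n`, and the comultiplication to
`c` if `i = n`. -/
noncomputable def faceTrans : ∀ (n : ℕ) (i : Fin (n + 1)),
    face n i ⋙ c.treeFunctor n ⟶ c.treeFunctor (n + 1)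
  | 0, _ => c.comul
  | n + 1, ⟨0, _⟩ => cocompWreath O.cocomp (c.treeFunctor n)
  | n + 1, ⟨i + 1, h⟩ => circMap O.obj (faceTrans n ⟨i, Nat.lt_of_succ_lt_succ h⟩)

/-- The natural transformation `(O^{⊚ (n + 1)} ⊚ c) s_i ⟶ O^{⊚ n} ⊚ c` that applies the counit
to the `i`-th factor `O` (counted from `0`). -/
noncomputable def degenTrans : ∀ (n : ℕ) (i : Fin (n + 1)),
    degen n i ⋙ c.treeFunctor (n + 1) ⟶ c.treeFunctor n
  | 0, _ => counitPoint O.counit (c.treeFunctor 0)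
  | n + 1, ⟨0, _⟩ => counitPoint O.counit (c.treeFunctor (n + 1))
  | n + 1, ⟨i + 1, h⟩ => circMap O.obj (degenTrans n ⟨i, Nat.lt_of_succ_lt_succ h⟩)

end Coalgebra

end Counit

section Complex

variable {C : Type u} [Category.{v} C] [MonoidalCategory C] [SymmetricCategory C] [HasLimits C]

instance hasRightKan (n : ℕ) (F : Level n ⥤ C) : (gam n).HasPointwiseRightKanExtension F := by
  have : HasLimitsOfSize.{0, 0} C := hasLimitsOfSizeShrink.{0, 0, v, v} C
  intro E
  have := hasLimitsOfShape_of_essentiallySmall.{0} (StructuredArrow E (gam n)) C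
  infer_instance

namespace Coalgebra

variable {O : Cooperad C} (c : Coalgebra O)

/-- The right Kan extension of `O^{⊚ n} ⊚ c` along `γ̄`. -/
noncomputable def kan (n : ℕ) : Sigma0 ⥤ C := (gam n).rightKanExtension (c.treeFunctor n)

/-- The universal natural transformation of the right Kan extension. -/
noncomputable def proj (n : ℕ) : gam n ⋙ c.kan n ⟶ c.treeFunctor n :=
  (gam n).rightKanExtensionCounit (c.treeFunctor n)

instance isRightKan (n : ℕ) : (c.kan n).IsRightKanExtension (c.proj n) :=
  inferInstanceAs (((gam n).rightKanExtension (c.treeFunctor n)).IsRightKanExtension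
    ((gam n).rightKanExtensionCounit (c.treeFunctor n)))

/-- The universal property of the right Kan extension. -/
noncomputable def lift (n : ℕ) (B : Sigma0 ⥤ C) (β : gam n ⋙ B ⟶ c.treeFunctor n) :
    B ⟶ c.kan n :=
  (c.kan n).liftOfIsRightKanExtension (c.proj n) B β

/-- The object `O^{∘̂ n} ∘̂ c` of `C`: the value at `∅` of the right Kan extension. -/
noncomputable def term (n : ℕ) : C := (c.kan n).obj empty

/-- The coface `O^{∘̂ n} ∘̂ c ⟶ O^{∘̂ (n + 1)} ∘̂ c` induced by `faceTrans n i`; note that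
`γ̄ ∂_i = γ̄`. -/
noncomputable def coface (n : ℕ) (i : Fin (n + 1)) : c.term n ⟶ c.term (n + 1) :=
  (c.lift (n + 1) (c.kan n)
    (Functor.whiskerLeft (face n i) (c.proj n) ≫ c.faceTrans n i)).app empty

/-- The codegeneracy `O^{∘̂ (n + 1)} ∘̂ c ⟶ O^{∘̂ n} ∘̂ c` induced by `degenTrans n i`; note that
`γ̄ s_i = γ̄`. -/
noncomputable def codegen (n : ℕ) (i : Fin (n + 1)) : c.term (n + 1) ⟶ c.term n :=
  (c.lift n (c.kan (n + 1))
    (Functor.whiskerLeft (degen n i) (c.proj (n + 1)) ≫ c.degenTrans n i)).app empty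

/-- The map `Δ_c : c ⟶ O ∘̂ c` induced by the comultiplication. -/
noncomputable def coaug : c.obj ⟶ c.term 1 :=
  (c.lift 1 ((Functor.const Sigma0).obj c.obj) c.comul).app empty

/-- The map `O ∘̂ c ⟶ c` induced by the counit of `O`. -/
noncomputable def coaugRetract : c.term 1 ⟶ c.obj :=
  (c.proj 1).app ((Wreath.point Sigma0).obj empty) ≫ (c.degenTrans 0 0).app empty

end Coalgebra
end Complex
end Circ
end TreeCooperad

/-!
A composite of associators, unitors and symmetries between two products of the same pairwise
distinct factors is unique. Hence `merge` is natural, associative and unital, and the whiskerings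
of `Δ̃` and `ε̃` with functors satisfy on the categories of trees the cosimplicial identities and
those of an extra codegeneracy, up to the isomorphisms between trees that compare the two ways of
forgetting or doubling levels. All functors between categories of trees commute with `γ̄`, so the
universal property of the right Kan extension turns these relations of natural transformations
into identities of morphisms. Since `Δ` is presented by cofaces and codegeneracies with the
cosimplicial identities as relations, the terms form a cosimplicial object.
-/

namespace TreeCooperad

open Word

section IsCoherent

variable {U : Type}

theorem Word.flat_mul (a b : Word U) : (mul a b).flat [] = a.flat [] ++ b.flat [] := by
  rw [flat, flat_append]

theorem Word.FHom.perm {e e' : Word U} (f : FHom e e') : (e.flat []).Perm (e'.flat []) := by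
  induction f with
  | comp _ _ hf hg => exact hf.trans hg
  | tensor _ _ hf hg => simpa only [flat_mul] using hf.append hg
  | braid a b => simpa only [flat_mul] using List.perm_append_comm
  | _ => exact .refl _

variable {C : Type u} [Category.{v} C] [MonoidalCategory C] [SymmetricCategory C] {Z : U → C}

/-- With `A` and `B` identified with formal products of objects `Z u` through `a` and `b`, the
morphism `m : A ⟶ B` is a composite of associators, unitors and symmetries. -/
def IsCoherent {A B : C} {e e' : Word U} (a : A ⟶ e.ev Z) (b : B ⟶ e'.ev Z) (m : A ⟶ B) : Prop :=
  ∃ f : FHom e e', m ≫ b = a ≫ f.interp Z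

/-- The identification of the unit object with the empty formal product. -/
def unitIdent (Z : U → C) : 𝟙_ C ⟶ one.ev Z := 𝟙 (𝟙_ C)

/-- The identification of `Z u` with the formal product that consists of the factor `u`. -/
def leafIdent (Z : U → C) (u : U) : Z u ⟶ (of u).ev Z := 𝟙 (Z u)

/-- The identification of `A ⊗ B` with a formal product, from identifications of `A` and `B`. -/
def tensorIdent {A B : C} {e e' : Word U} (a : A ⟶ e.ev Z) (b : B ⟶ e'.ev Z) :
    A ⊗ B ⟶ (mul e e').ev Z :=
  a ⊗ₘ b

/-- The identification of `tens X` with a formal product, from identifications of its factors. -/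
noncomputable def tensIdent {S : Type} [Finite S] {X : S → C} {k : S → Word U}
    (a : ∀ s, X s ⟶ (k s).ev Z) : tens X ⟶ ((std S).bind k).ev Z :=
  evBind k a (std S)

instance (Z : U → C) (u : U) : IsIso (leafIdent Z u) :=
  inferInstanceAs (IsIso (𝟙 (Z u)))

instance {A B : C} {e e' : Word U} (a : A ⟶ e.ev Z) (b : B ⟶ e'.ev Z) [IsIso a] [IsIso b] :
    IsIso (tensorIdent a b) :=
  inferInstanceAs (IsIso (a ⊗ₘ b))

instance {S : Type} [Finite S] {X : S → C} {k : S → Word U} (a : ∀ s, X s ⟶ (k s).ev Z)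
    [∀ s, IsIso (a s)] : IsIso (tensIdent a) :=
  evBind_isIso k a (std S)

namespace IsCoherent

variable {A A' B B' D : C} {e e' e'' k k' : Word U}

theorem unique {a : A ⟶ e.ev Z} {b : B ⟶ e'.ev Z} [Mono b] {m m' : A ⟶ B}
    (h : IsCoherent a b m) (h' : IsCoherent a b m') (he : (e.flat []).Nodup) : m = m' := by
  obtain ⟨f, hf⟩ := h
  obtain ⟨f', hf'⟩ := h'
  rw [← cancel_mono b, hf, hf', f.coherence Z (f.perm.nodup_iff.1 he) f']

theorem id (a : A ⟶ e.ev Z) : IsCoherent a a (𝟙 A) :=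
  ⟨.id _, (Category.id_comp _).trans (Category.comp_id _).symm⟩

theorem comp {a : A ⟶ e.ev Z} {b : B ⟶ e'.ev Z} {d : D ⟶ e''.ev Z} {m : A ⟶ B} {m' : B ⟶ D}
    (h : IsCoherent a b m) (h' : IsCoherent b d m') : IsCoherent a d (m ≫ m') := by
  obtain ⟨f, hf⟩ := h
  obtain ⟨f', hf'⟩ := h'
  exact ⟨f.comp f', by simp only [FHom.interp, Category.assoc, hf', reassoc_of% hf]⟩

theorem inv {a : A ⟶ e.ev Z} {b : B ⟶ e'.ev Z} {m : A ⟶ B} [IsIso m] (h : IsCoherent a b m) :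
    IsCoherent b a (CategoryTheory.inv m) := by
  obtain ⟨f, hf⟩ := h
  obtain ⟨g, hg⟩ := f.exists_inv Z
  exact ⟨g, by rw [IsIso.inv_comp_eq, reassoc_of% hf, hg, Category.comp_id]⟩

theorem tensor {a : A ⟶ e.ev Z} {b : B ⟶ e'.ev Z} {a' : A' ⟶ k.ev Z} {b' : B' ⟶ k'.ev Z}
    {m : A ⟶ A'} {n : B ⟶ B'} (h : IsCoherent a a' m) (h' : IsCoherent b b' n) :
    IsCoherent (tensorIdent a b) (tensorIdent a' b') (m ⊗ₘ n) := by
  obtain ⟨f, hf⟩ := h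
  obtain ⟨f', hf'⟩ := h'
  exact ⟨f.tensor f', (tensorHom_comp_tensorHom _ _ _ _).trans
    ((congr_arg₂ (· ⊗ₘ ·) hf hf').trans (tensorHom_comp_tensorHom _ _ _ _).symm)⟩

theorem whiskerLeft (a : A ⟶ e.ev Z) {b : B ⟶ e'.ev Z} {b' : B' ⟶ k'.ev Z} {n : B ⟶ B'}
    (h : IsCoherent b b' n) : IsCoherent (tensorIdent a b) (tensorIdent a b') (A ◁ n) :=
  id_tensorHom A n ▸ (id a).tensor h

theorem associator (a : A ⟶ e.ev Z) (b : B ⟶ e'.ev Z) (d : D ⟶ e''.ev Z) :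
    IsCoherent (tensorIdent (tensorIdent a b) d) (tensorIdent a (tensorIdent b d))
      (α_ A B D).hom :=
  ⟨.assoc _ _ _, (associator_naturality a b d).symm⟩

theorem leftUnitor (a : A ⟶ e.ev Z) :
    IsCoherent (tensorIdent (unitIdent Z) a) a (λ_ A).hom :=
  ⟨.leftU _, ((congr_arg (· ≫ _) (id_tensorHom _ a)).trans (leftUnitor_naturality a)).symm⟩

variable {S T : Type}

theorem canon {X : S → C} {l : S → Word U} (b : ∀ s, X s ⟶ (l s).ev Z) {w w' : Word S}
    (h : (w.flat []).Perm (w'.flat [])) :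
    IsCoherent (evBind l b w) (evBind l b w') (Word.canon X w w' h) :=
  ⟨_, interp_evBind l b _⟩

theorem evBind {X : S → C} {Y : T → C} {k : S → Word T} {φ : ∀ s, X s ⟶ (k s).ev Y}
    {K : S → Word U} {L : T → Word U} {a : ∀ s, X s ⟶ (K s).ev Z} {b : ∀ t, Y t ⟶ (L t).ev Z}
    (h : ∀ s, IsCoherent (a s) (Word.evBind L b (k s)) (φ s)) (w : Word S) :
    IsCoherent (Word.evBind K a w) (Word.evBind L b (w.bind k)) (Word.evBind k φ w) := by
  induction w with
  | one => exact id _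
  | of s => exact h s
  | mul w w' hw hw' => exact hw.tensor hw'

variable [Finite S] [Finite T]

theorem tensMap {X : S → C} {Y : T → C} {k : S → Word U} {l : T → Word U}
    {a : ∀ s, X s ⟶ (k s).ev Z} {b : ∀ t, Y t ⟶ (l t).ev Z} (σ : S ≃ T)
    {φ : ∀ s, X s ⟶ Y (σ s)} (h : ∀ s, IsCoherent (a s) (b (σ s)) (φ s)) :
    IsCoherent (tensIdent a) (tensIdent b) (TreeCooperad.tensMap σ φ) :=
  (evBind (k := fun s => of (σ s)) h (std S)).comp (canon b _)

theorem tensPoint (a : A ⟶ e.ev Z) :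
    IsCoherent (tensIdent fun _ : PUnit => a) a (TreeCooperad.tensPoint A) :=
  canon (w' := of PUnit.unit) (fun _ => a) _

variable (Z S) in
theorem tensUnit :
    IsCoherent (tensIdent fun _ : S => unitIdent Z) (unitIdent Z) (TreeCooperad.tensUnit S) :=
  (evBind (T := PEmpty) (k := fun _ => one) (φ := fun _ => 𝟙 (𝟙_ C)) (L := fun x => x.elim)
    (b := fun x => x.elim) (fun _ => id (unitIdent Z)) (std S)).comp (canon (w' := one) _ _)

theorem incl {V : Type} (X : V → C) {k : V → Word U} (a : ∀ v, X v ⟶ (k v).ev Z) (ι : S → V) :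
    IsCoherent (tensIdent fun s => a (ι s)) (Word.evBind k a ((std S).bind fun s => of (ι s)))
      (TreeCooperad.incl X ι) :=
  evBind (k := fun s => of (ι s)) (fun s => id (a (ι s))) (std S)

theorem merge {P : S → C} {R : S → Type} [∀ s, Finite (R s)] {Q : ∀ s, R s → C}
    {k : S → Word U} {l : ∀ s, R s → Word U} (p : ∀ s, P s ⟶ (k s).ev Z)
    (q : ∀ s r, Q s r ⟶ (l s r).ev Z) :
    IsCoherent (tensorIdent (tensIdent p) (tensIdent fun x : Σ s, R s => q x.1 x.2))
      (tensIdent fun s => tensorIdent (p s) (tensIdent (q s))) (TreeCooperad.merge P Q) := by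
  let z : ∀ u, mergeFam P Q u ⟶ (Sum.elim k (fun x => l x.1 x.2) u).ev Z
    | .inl s => p s
    | .inr x => q x.1 x.2
  have splitSrc : IsCoherent _ (Word.evBind _ z (mergeSrc S R)) (splitSrc P Q) :=
    (incl (mergeFam P Q) z .inl).tensor (incl (mergeFam P Q) z .inr)
  have splitTgt : IsCoherent _ (Word.evBind _ z ((std S).bind (mergeTgt S R))) (splitTgt P Q) :=
    evBind (fun s => (id (p s)).tensor (incl (mergeFam P Q) z fun r => .inr ⟨s, r⟩)) (std S)
  exact splitSrc.comp ((canon z _).comp splitTgt.inv)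

end IsCoherent

end IsCoherent

section Tens

variable {C : Type u} [Category.{v} C] [MonoidalCategory C] [SymmetricCategory C]

/-- The tensor product of the morphisms `φ s`. -/
noncomputable def tensHom {S : Type} [Finite S] {X Y : S → C} (φ : ∀ s, X s ⟶ Y s) :
    tens X ⟶ tens Y :=
  tensMap (Equiv.refl S) φ

/-- The isomorphism that relabels the factors of a tensor product along a bijection. -/
noncomputable def tensReindex {S T : Type} [Finite S] [Finite T] (σ : S ≃ T) (Y : T → C) :
    tens (fun s => Y (σ s)) ⟶ tens Y :=
  tensMap σ fun s => 𝟙 (Y (σ s))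

theorem tensHom_id {S : Type} [Finite S] (X : S → C) : tensHom (fun s => 𝟙 (X s)) = 𝟙 (tens X) :=
  tensMap_id X

theorem tensHom_comp {S : Type} [Finite S] {X Y Z : S → C} (φ : ∀ s, X s ⟶ Y s)
    (ψ : ∀ s, Y s ⟶ Z s) : tensHom φ ≫ tensHom ψ = tensHom fun s => φ s ≫ ψ s :=
  (tensMap_comp (Equiv.refl S) (Equiv.refl S) φ ψ).symm

theorem Word.nodup_flat_mul {U : Type} {e e' : Word U} (he : (e.flat []).Nodup)
    (he' : (e'.flat []).Nodup) (h : ∀ u ∈ e.flat [], u ∉ e'.flat []) :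
    ((mul e e').flat []).Nodup := by
  rw [flat_mul]
  exact he.append he' h

theorem nodup_flat_std_bind_of {S U : Type} [Finite S] {ι : S → U} (hι : ι.Injective) :
    (((std S).bind fun s => of (ι s)).flat []).Nodup := by
  rw [flat_bind_of]
  exact (std_full S).1.map hι

theorem merge_assoc {I : Type} [Finite I] {J : I → Type} [∀ i, Finite (J i)]
    {K : ∀ i, J i → Type} [∀ i j, Finite (K i j)]
    (P : I → C) (P' : ∀ i, J i → C) (Q : ∀ i j, K i j → C) :
    (α_ (tens P) (tens fun p : Σ i, J i => P' p.1 p.2)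
        (tens fun x : Σ p : (Σ i, J i), K p.1 p.2 => Q x.1.1 x.1.2 x.2)).hom ≫
      (tens P ◁ merge (fun p : Σ i, J i => P' p.1 p.2) (fun p k => Q p.1 p.2 k)) ≫
      merge P (fun i j => P' i j ⊗ tens (Q i j)) =
    (merge P P' ⊗ₘ tensReindex (Equiv.sigmaAssoc K) fun x => Q x.1 x.2.1 x.2.2) ≫
      merge (R := fun i => Σ j, K i j) (fun i => P i ⊗ tens (P' i)) (fun i x => Q i x.1 x.2) ≫
      tensHom fun i => (α_ _ _ _).hom ≫ (P i ◁ merge (P' i) (Q i)) := by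
  let Z : I ⊕ ((Σ i, J i) ⊕ (Σ p : (Σ i, J i), K p.1 p.2)) → C :=
    Sum.elim P (Sum.elim (fun p => P' p.1 p.2) fun x => Q x.1.1 x.1.2 x.2)
  let p : ∀ i, P i ⟶ (of (.inl i)).ev Z := fun i => leafIdent Z (.inl i)
  let p' : ∀ i j, P' i j ⟶ (of (.inr (.inl ⟨i, j⟩))).ev Z := fun i j =>
    leafIdent Z (.inr (.inl ⟨i, j⟩))
  let q : ∀ i j k, Q i j k ⟶ (of (.inr (.inr ⟨⟨i, j⟩, k⟩))).ev Z := fun i j k =>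
    leafIdent Z (.inr (.inr ⟨⟨i, j⟩, k⟩))
  have : ∀ i, IsIso (p i) := fun i => inferInstanceAs (IsIso (leafIdent Z (.inl i)))
  have : ∀ i j, IsIso (p' i j) := fun i j =>
    inferInstanceAs (IsIso (leafIdent Z (.inr (.inl ⟨i, j⟩))))
  have : ∀ i j k, IsIso (q i j k) := fun i j k =>
    inferInstanceAs (IsIso (leafIdent Z (.inr (.inr ⟨⟨i, j⟩, k⟩))))
  let src := tensorIdent (tensorIdent (tensIdent p) (tensIdent fun x : Σ i, J i => p' x.1 x.2))
    (tensIdent fun x : Σ p : (Σ i, J i), K p.1 p.2 => q x.1.1 x.1.2 x.2)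
  let tgt := tensIdent fun i =>
    tensorIdent (p i) (tensIdent fun j => tensorIdent (p' i j) (tensIdent (q i j)))
  have : IsIso tgt := inferInstance
  have lhs : IsCoherent src tgt _ :=
    (IsCoherent.associator _ _ _).comp ((IsCoherent.whiskerLeft _ (IsCoherent.merge
      (fun x : Σ i, J i => p' x.1 x.2) fun x => q x.1 x.2)).comp
      (IsCoherent.merge p fun i j => tensorIdent (p' i j) (tensIdent (q i j))))
  have rhs : IsCoherent src tgt _ :=
    ((IsCoherent.merge p p').tensor (IsCoherent.tensMap (b := fun x => q x.1 x.2.1 x.2.2)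
      (Equiv.sigmaAssoc K) fun _ => .id _)).comp
      ((IsCoherent.merge (R := fun i => Σ j, K i j) _ fun i x => q i x.1 x.2).comp
        (IsCoherent.tensMap (Equiv.refl I) fun i => (IsCoherent.associator _ _ _).comp
          (.whiskerLeft (p i) (.merge (p' i) (q i)))))
  refine lhs.unique rhs (nodup_flat_mul (nodup_flat_mul ?_ ?_ ?_) ?_ ?_)
  · exact nodup_flat_std_bind_of Sum.inl_injective
  · exact nodup_flat_std_bind_of (Sum.inr_injective.comp Sum.inl_injective)
  · simp [flat_bind_of]
  · exact nodup_flat_std_bind_of (Sum.inr_injective.comp Sum.inr_injective)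
  · simp [flat_mul, flat_bind_of]

theorem merge_tensPoint {R : Type} [Finite R] (P : C) (Q : R → C) :
    merge (fun _ : PUnit => P) (fun _ => Q) ≫ tensPoint (P ⊗ tens Q) =
      tensPoint P ⊗ₘ tensReindex (Equiv.uniqueSigma fun _ : PUnit => R) Q := by
  let Z : PUnit ⊕ R → C := Sum.elim (fun _ => P) Q
  let p : P ⟶ (of (.inl PUnit.unit)).ev Z := leafIdent Z (.inl PUnit.unit)
  let q : ∀ r, Q r ⟶ (of (.inr r)).ev Z := fun r => leafIdent Z (.inr r)
  have : IsIso p := inferInstanceAs (IsIso (leafIdent Z (.inl PUnit.unit)))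
  have : ∀ r, IsIso (q r) := fun r => inferInstanceAs (IsIso (leafIdent Z (.inr r)))
  let src := tensorIdent (tensIdent fun _ : PUnit => p) (tensIdent fun x : Σ _ : PUnit, R => q x.2)
  have lhs : IsCoherent src (tensorIdent p (tensIdent q)) _ :=
    (IsCoherent.merge (fun _ : PUnit => p) fun _ => q).comp (.tensPoint _)
  have rhs : IsCoherent src (tensorIdent p (tensIdent q)) _ :=
    (IsCoherent.tensPoint p).tensor
      (.tensMap (b := q) (Equiv.uniqueSigma fun _ : PUnit => R) fun _ => .id _)
  refine lhs.unique rhs (nodup_flat_mul ?_ ?_ ?_)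
  · exact nodup_flat_std_bind_of (ι := fun _ : PUnit => Sum.inl PUnit.unit)
      fun _ _ _ => rfl
  · exact nodup_flat_std_bind_of (Sum.inr_injective.comp
      (Equiv.uniqueSigma fun _ : PUnit => R).injective)
  · simp [flat_bind_of]

theorem merge_tensUnit {S : Type} [Finite S] (Q : S → C) :
    merge (R := fun _ => PUnit) (fun _ : S => 𝟙_ C) (fun s _ => Q s) ≫
      tensHom (fun s => (𝟙 (𝟙_ C) ⊗ₘ tensPoint (Q s)) ≫ (λ_ (Q s)).hom) =
    (tensUnit S ⊗ₘ tensReindex (Equiv.sigmaPUnit S) Q) ≫ (λ_ (tens Q)).hom := by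
  let src := tensorIdent (tensIdent fun _ : S => unitIdent Q)
    (tensIdent fun x : Σ _ : S, PUnit => leafIdent Q x.1)
  have lhs : IsCoherent src (tensIdent (leafIdent Q)) _ :=
    (IsCoherent.merge (fun _ => unitIdent Q) fun s _ => leafIdent Q s).comp
      (.tensMap (Equiv.refl S) fun s =>
        ((IsCoherent.id (unitIdent Q)).tensor (.tensPoint (leafIdent Q s))).comp (.leftUnitor _))
  have rhs : IsCoherent src (tensIdent (leafIdent Q)) _ :=
    ((IsCoherent.tensUnit Q S).tensor (.tensMap (b := leafIdent Q) (Equiv.sigmaPUnit S)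
      fun _ => .id _)).comp (.leftUnitor _)
  have units : ((std S).bind fun _ => (one : Word S)).flat [] = [] := by simp [flat_bind, flat]
  refine lhs.unique rhs (nodup_flat_mul ?_ ?_ ?_)
  · rw [units]
    exact List.nodup_nil
  · exact nodup_flat_std_bind_of (Equiv.sigmaPUnit S).injective
  · simp [units]

variable {S : Type} [Finite S] {R : S → Type} [∀ s, Finite (R s)]

theorem tensHom_whiskerRight_merge {P P' : S → C} (p : ∀ s, P s ⟶ P' s) (Q : ∀ s, R s → C) :
    (tensHom p ▷ tens fun x : Σ s, R s => Q x.1 x.2) ≫ merge P' Q =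
      merge P Q ≫ tensHom fun s => p s ▷ tens (Q s) := by
  have natural := merge_natural (Equiv.refl S) (fun s => Equiv.refl (R s)) p fun s r => 𝟙 (Q s r)
  simp only [← tensorHom_id, ← tensHom_id]
  exact natural

theorem whiskerLeft_tensHom_merge (P : S → C) {Q Q' : ∀ s, R s → C}
    (q : ∀ s r, Q s r ⟶ Q' s r) :
    (tens P ◁ tensHom fun x : Σ s, R s => q x.1 x.2) ≫ merge P Q' =
      merge P Q ≫ tensHom fun s => P s ◁ tensHom (q s) := by
  have natural := merge_natural (Equiv.refl S) (fun s => Equiv.refl (R s)) (fun s => 𝟙 (P s)) q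
  simp only [← id_tensorHom]
  rw [← tensHom_id P]
  exact natural

end Tens

section Transfer

variable {C : Type u} [Category.{v} C] [MonoidalCategory C]

/-- The morphism `A ⊗ Q ⟶ B ⊗ M` that splits `P` off from `A` by `d` and absorbs it into `Q` by
`m`. Whiskering a cocomposition with a functor is an instance, with `m` a `merge`. -/
def transfer {A B P Q M : C} (d : A ⟶ B ⊗ P) (m : P ⊗ Q ⟶ M) : A ⊗ Q ⟶ B ⊗ M :=
  (d ⊗ₘ 𝟙 Q) ≫ (α_ B P Q).hom ≫ (B ◁ m)

variable {A A' B D P P' Q Q' M M' N X : C}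

theorem transfer_comp_whiskerLeft (d : A ⟶ B ⊗ P) (m : P ⊗ Q ⟶ M) (n : M ⟶ N) :
    transfer d m ≫ (B ◁ n) = transfer d (m ≫ n) := by
  simp only [transfer, Category.assoc, MonoidalCategory.whiskerLeft_comp]

theorem transfer_whiskerRight_comp (d : A ⟶ B ⊗ P) (f : P ⟶ P') (m : P' ⊗ Q ⟶ M) :
    transfer d (f ▷ Q ≫ m) = transfer (d ≫ (B ◁ f)) m := by
  simp [transfer]

theorem tensorHom_comp_transfer (g : A ⟶ A') (σ : Q ⟶ Q') (d : A' ⟶ B ⊗ P) (m : P ⊗ Q' ⟶ M) :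
    (g ⊗ₘ σ) ≫ transfer d m = transfer (g ≫ d) ((P ◁ σ) ≫ m) := by
  simp [transfer, MonoidalCategory.tensorHom_def, whisker_exchange_assoc]

theorem transfer_comp_transfer (d : A ⟶ B ⊗ P') (d' : B ⟶ D ⊗ P) (m : P' ⊗ Q ⟶ M)
    (m' : P ⊗ M ⟶ N) :
    transfer d m ≫ transfer d' m' =
      transfer (d ≫ transfer d' (𝟙 (P ⊗ P'))) ((α_ P P' Q).hom ≫ (P ◁ m) ≫ m') := by
  simp [transfer, whisker_exchange_assoc]

theorem transfer_assoc {R : C} {d : A ⟶ B ⊗ P'} {d' : B ⟶ D ⊗ P} {m : P ⊗ P' ⟶ X}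
    {g : A ⟶ A'} {e : A' ⟶ D ⊗ R} {f : R ⟶ X} (h : d ≫ transfer d' m = g ≫ e ≫ (D ◁ f))
    {m₁ : P' ⊗ Q ⟶ M} {m₂ : P ⊗ M ⟶ N} {σ : Q ⟶ Q'} {n : X ⊗ Q' ⟶ N}
    (hm : (α_ P P' Q).hom ≫ (P ◁ m₁) ≫ m₂ = (m ⊗ₘ σ) ≫ n) :
    transfer d m₁ ≫ transfer d' m₂ = (g ⊗ₘ σ) ≫ transfer e (f ▷ Q' ≫ n) :=
  calc transfer d m₁ ≫ transfer d' m₂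
    _ = transfer (d ≫ transfer d' (𝟙 _)) (m ▷ Q ≫ (X ◁ σ) ≫ n) := by
      rw [transfer_comp_transfer, hm, MonoidalCategory.tensorHom_def, Category.assoc]
    _ = transfer (g ≫ e ≫ (D ◁ f)) ((X ◁ σ) ≫ n) := by
      rw [transfer_whiskerRight_comp, Category.assoc, transfer_comp_whiskerLeft,
        Category.id_comp, h]
    _ = (g ⊗ₘ σ) ≫ transfer e (f ▷ Q' ≫ n) := by
      rw [transfer_whiskerRight_comp, tensorHom_comp_transfer]

theorem transfer_comp_leftUnitor (d : A ⟶ B ⊗ P) (ε : B ⟶ 𝟙_ C) (t : P ⟶ P') {m : P ⊗ Q ⟶ M}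
    {n : M ⟶ P' ⊗ Q'} {σ : Q ⟶ Q'} (h : m ≫ n = t ⊗ₘ σ) :
    transfer d m ≫ (ε ⊗ₘ n) ≫ (λ_ (P' ⊗ Q')).hom = (d ≫ (ε ⊗ₘ t) ≫ (λ_ P').hom) ⊗ₘ σ := by
  have absorb : (B ◁ m) ≫ (ε ⊗ₘ n) = ε ⊗ₘ (t ⊗ₘ σ) := by
    rw [← h, ← id_tensorHom, tensorHom_comp_tensorHom, Category.id_comp]
  simp only [transfer, Category.assoc, reassoc_of% absorb]
  simp [MonoidalCategory.tensorHom_def]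

theorem transfer_leftUnitor (d : A ⟶ B ⊗ P) (t : P ⟶ 𝟙_ C) (σ : Q ⟶ Q') :
    transfer d ((t ⊗ₘ σ) ≫ (λ_ Q').hom) = (d ≫ (B ◁ t) ≫ (ρ_ B).hom) ⊗ₘ σ := by
  simp [transfer, MonoidalCategory.tensorHom_def]

end Transfer

section Distrib

variable {C : Type u} [Category.{v} C] [MonoidalCategory C] [SymmetricCategory C]

variable {A A' B D : C}

theorem transfer_merge_natural {S : Type} [Finite S] {R : S → Type} [∀ s, Finite (R s)] {P : S → C}
    (d : A ⟶ B ⊗ tens P) {Q Q' : ∀ s, R s → C} (q : ∀ s r, Q s r ⟶ Q' s r) :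
    transfer d (merge P Q) ≫ (B ◁ tensHom fun s => P s ◁ tensHom (q s)) =
      (A ◁ tensHom fun x : Σ s, R s => q x.1 x.2) ≫ transfer d (merge P Q') := by
  rw [transfer_comp_whiskerLeft, ← whiskerLeft_tensHom_merge, ← id_tensorHom A,
    tensorHom_comp_transfer, Category.id_comp]

theorem transfer_merge_assoc {I : Type} [Finite I] {J : I → Type} [∀ i, Finite (J i)]
    {K : ∀ i, J i → Type} [∀ i j, Finite (K i j)] {P R : I → C} {P' : ∀ i, J i → C}
    {d : A ⟶ B ⊗ tens fun p : Σ i, J i => P' p.1 p.2} {d' : B ⟶ D ⊗ tens P} {g : A ⟶ A'}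
    {e : A' ⟶ D ⊗ tens R} {f : ∀ i, R i ⟶ P i ⊗ tens (P' i)}
    (h : d ≫ transfer d' (merge P P') = g ≫ e ≫ (D ◁ tensHom f)) (Q : ∀ i j, K i j → C) :
    transfer d (merge (fun p : Σ i, J i => P' p.1 p.2) fun p k => Q p.1 p.2 k) ≫
        transfer d' (merge P fun i j => P' i j ⊗ tens (Q i j)) =
      (g ⊗ₘ tensReindex (Equiv.sigmaAssoc K) fun x => Q x.1 x.2.1 x.2.2) ≫
        transfer e (merge (R := fun i => Σ j, K i j) R fun i x => Q i x.1 x.2) ≫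
        (D ◁ tensHom fun i => transfer (f i) (merge (P' i) (Q i))) := by
  rw [transfer_assoc h (merge_assoc P P' Q), transfer_comp_whiskerLeft,
    reassoc_of% tensHom_whiskerRight_merge (R := fun i => Σ j, K i j) f fun i x => Q i x.1 x.2,
    tensHom_comp]
  simp only [transfer, tensorHom_id]
  rfl

theorem transfer_merge_tensPoint {R : Type} [Finite R] {P : C}
    (d : A ⟶ B ⊗ tens fun _ : PUnit => P) (ε : B ⟶ 𝟙_ C) (Q : R → C) :
    transfer d (merge (fun _ => P) fun _ => Q) ≫ (ε ⊗ₘ tensPoint (P ⊗ tens Q)) ≫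
        (λ_ (P ⊗ tens Q)).hom =
      (d ≫ (ε ⊗ₘ tensPoint P) ≫ (λ_ P).hom) ⊗ₘ
        tensReindex (Equiv.uniqueSigma fun _ : PUnit => R) Q :=
  transfer_comp_leftUnitor d ε _ (merge_tensPoint P Q)

theorem transfer_merge_tensUnit {S : Type} [Finite S] {P : C} (d : A ⟶ B ⊗ tens fun _ : S => P)
    (ε : P ⟶ 𝟙_ C) (Q : S → C) :
    transfer d (merge (R := fun _ => PUnit) (fun _ => P) fun s _ => Q s) ≫
        (B ◁ tensHom fun s => (ε ⊗ₘ tensPoint (Q s)) ≫ (λ_ (Q s)).hom) =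
      (d ≫ (B ◁ (tensHom (fun _ => ε) ≫ tensUnit S)) ≫ (ρ_ B).hom) ⊗ₘ
        tensReindex (Equiv.sigmaPUnit S) Q := by
  have split (s : S) : (ε ⊗ₘ tensPoint (Q s)) ≫ (λ_ (Q s)).hom =
      ε ▷ _ ≫ (𝟙 _ ⊗ₘ tensPoint (Q s)) ≫ (λ_ (Q s)).hom := by
    rw [id_tensorHom, MonoidalCategory.tensorHom_def, Category.assoc]
  have absorb : merge (R := fun _ => PUnit) (fun _ => P) (fun s _ => Q s) ≫
      tensHom (fun s => (ε ⊗ₘ tensPoint (Q s)) ≫ (λ_ (Q s)).hom) =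
      ((tensHom (fun _ => ε) ≫ tensUnit S) ⊗ₘ tensReindex (Equiv.sigmaPUnit S) Q) ≫
        (λ_ (tens Q)).hom := by
    rw [funext split, ← tensHom_comp,
      ← reassoc_of% tensHom_whiskerRight_merge (R := fun _ => PUnit), merge_tensUnit,
      MonoidalCategory.tensorHom_def, MonoidalCategory.tensorHom_def, comp_whiskerRight]
    simp only [Category.assoc]
    rfl
  rw [transfer_comp_whiskerLeft, absorb]
  exact transfer_leftUnitor d _ _

theorem tensHom_comp_tensPoint {X Y : C} (ε : A ⟶ 𝟙_ C) (φ : X ⟶ Y) :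
    (A ◁ tensHom fun _ : PUnit => φ) ≫ (ε ⊗ₘ tensPoint Y) ≫ (λ_ Y).hom =
      ((ε ⊗ₘ tensPoint X) ≫ (λ_ X).hom) ≫ φ := by
  rw [← id_tensorHom, tensorHom_comp_tensorHom_assoc, Category.id_comp, tensHom,
    tensPoint_natural φ]
  simp [MonoidalCategory.tensorHom_def]

end Distrib

section EqUpToMap

variable {C : Type u} [Category.{v} C] {W : Type*} [Category* W] (T : W ⥤ C) {x y : W} {A : C}

/-- Two morphisms from values of `T` are equal after the identification of these values along
some morphism of `W`. For functors on trees, that morphism is an isomorphism between the trees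
obtained in two ways by forgetting and doubling levels. -/
def EqUpToMap (f : T.obj x ⟶ A) (g : T.obj y ⟶ A) : Prop :=
  ∃ a : x ⟶ y, f = T.map a ≫ g

variable {T}

theorem EqUpToMap.of_eq {f g : T.obj x ⟶ A} (h : f = g) : EqUpToMap T f g :=
  ⟨𝟙 x, by rw [h, T.map_id, Category.id_comp]⟩

theorem EqUpToMap.of_eq_map {f : T.obj x ⟶ T.obj y} (a : x ⟶ y) (h : f = T.map a) :
    EqUpToMap T f (𝟙 (T.obj y)) :=
  ⟨a, by rw [h, Category.comp_id]⟩

theorem EqUpToMap.congr {f f' : T.obj x ⟶ A} {g g' : T.obj y ⟶ A} (h : EqUpToMap T f g)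
    (hf : f' = f) (hg : g' = g) : EqUpToMap T f' g' :=
  hf ▸ hg ▸ h

end EqUpToMap

theorem eq_map_homOf {C : Type*} [Category* C] (O : FinBij ⥤ C) {S T : FinBij}
    (e : S.carrier ≃ T.carrier) {f : O.obj S ⟶ O.obj T}
    (h : O.map (FinBij.homOf e.symm) ≫ f = 𝟙 (O.obj T)) : f = O.map (FinBij.homOf e) := by
  have cancel : O.map (FinBij.homOf e) ≫ O.map (FinBij.homOf e.symm) = 𝟙 (O.obj S) :=
    (O.map_comp _ _).symm.trans ((congr_arg O.map e.self_trans_symm).trans (O.map_id S))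
  rw [← Category.id_comp f, ← cancel, Category.assoc, h, Category.comp_id]

section Circ

variable {C : Type u} [Category.{v} C] [MonoidalCategory C] [SymmetricCategory C]

section Whisker

variable {W : Type*} [Category* W] {T : W ⥤ C} {S : FinBij} {x y : S.carrier → W}

theorem whiskerLeft_tensHom_comp (A : C) {I : Type} [Finite I] {X Y Z : I → C}
    (φ : ∀ i, X i ⟶ Y i) (ψ : ∀ i, Y i ⟶ Z i) :
    (A ◁ tensHom φ) ≫ (A ◁ tensHom ψ) = A ◁ tensHom fun i => φ i ≫ ψ i := by
  rw [← MonoidalCategory.whiskerLeft_comp, tensHom_comp]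

theorem EqUpToMap.whisker (O : FinBij ⥤ C) {D : S.carrier → C}
    {f : ∀ s, T.obj (x s) ⟶ D s} {g : ∀ s, T.obj (y s) ⟶ D s}
    (h : ∀ s, EqUpToMap T (f s) (g s)) :
    EqUpToMap (circ O T) (x := ⟨S, x⟩) (y := ⟨S, y⟩) (O.obj S ◁ tensHom f)
      (O.obj S ◁ tensHom g) := by
  choose a ha using h
  let b : (⟨S, x⟩ : Wreath W) ⟶ ⟨S, y⟩ := ⟨Equiv.refl _, a⟩
  have map_b : (circ O T).map b = O.obj S ◁ tensHom fun s => T.map (a s) :=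
    (congr_arg (· ⊗ₘ _) (O.map_id S)).trans (id_tensorHom _ _)
  refine ⟨b, ?_⟩
  rw [map_b, funext ha]
  exact (whiskerLeft_tensHom_comp _ _ _).symm

theorem EqUpToMap.whisker_comp (O : FinBij ⥤ C) {B B' D : S.carrier → C}
    {f : ∀ s, T.obj (x s) ⟶ B s} {f' : ∀ s, B s ⟶ D s} {g : ∀ s, T.obj (y s) ⟶ B' s}
    {g' : ∀ s, B' s ⟶ D s} (h : ∀ s, EqUpToMap T (f s ≫ f' s) (g s ≫ g' s)) :
    EqUpToMap (circ O T) (x := ⟨S, x⟩) (y := ⟨S, y⟩)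
      ((O.obj S ◁ tensHom f) ≫ (O.obj S ◁ tensHom f'))
      ((O.obj S ◁ tensHom g) ≫ (O.obj S ◁ tensHom g')) :=
  (EqUpToMap.whisker O h).congr (whiskerLeft_tensHom_comp _ f f') (whiskerLeft_tensHom_comp _ g g')

theorem EqUpToMap.whisker_comp_id (O : FinBij ⥤ C) {B : S.carrier → C}
    {f : ∀ s, T.obj (x s) ⟶ B s} {f' : ∀ s, B s ⟶ T.obj (y s)}
    (h : ∀ s, EqUpToMap T (f s ≫ f' s) (𝟙 (T.obj (y s)))) :
    EqUpToMap (circ O T) (x := ⟨S, x⟩) (y := ⟨S, y⟩)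
      ((O.obj S ◁ tensHom f) ≫ (O.obj S ◁ tensHom f')) (𝟙 ((circ O T).obj ⟨S, y⟩)) := by
  refine (EqUpToMap.whisker O h).congr (whiskerLeft_tensHom_comp _ f f') ?_
  rw [tensHom_id, MonoidalCategory.whiskerLeft_id]
  rfl

end Whisker

section CocompWreath

variable {W : Type*} [Category* W]

/-- The morphism of `Σ_* ≀ W` from the family relabelled along a bijection to the family itself. -/
def Wreath.reindex {S : FinBij} (x : Wreath W) (e : S.carrier ≃ x.base.carrier) :
    (⟨S, fun s => x.fam (e s)⟩ : Wreath W) ⟶ x :=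
  ⟨e, fun s => 𝟙 (x.fam (e s))⟩

theorem circ_map_reindex (O : FinBij ⥤ C) (F : W ⥤ C) {S : FinBij} (x : Wreath W)
    (e : S.carrier ≃ x.base.carrier) :
    (circ O F).map (x.reindex e) =
      O.map (FinBij.homOf e) ⊗ₘ tensReindex e fun s => F.obj (x.fam s) :=
  congr_arg (fun φ => O.map (FinBij.homOf e) ⊗ₘ tensMap e φ) (funext fun _ => F.map_id _)

theorem cocompWreath_natural {O : FinBij ⥤ C} (Δ : Wreath.total ⋙ O ⟶ circ O O) {W' : Type*}
    [Category* W'] {G : W' ⥤ W} {F : W ⥤ C} {F' : W' ⥤ C} (θ : G ⋙ F ⟶ F')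
    (x : Wreath (Wreath W')) :
    (cocompWreath Δ F).app ((Wreath.map (Wreath.map G)).obj x) ≫
        (O.obj x.base ◁ tensHom fun s => (circMap O θ).app (x.fam s)) =
      (circMap O θ).app ((Wreath.flatten W').obj x) ≫ (cocompWreath Δ F').app x :=
  transfer_merge_natural (Δ.app ⟨x.base, fun s => (x.fam s).base⟩)
    fun s r => θ.app ((x.fam s).fam r)

variable [HasTerminal C] (O : Cooperad C) (F : W ⥤ C)

theorem cocompWreath_coassoc (x : Wreath (Wreath (Wreath W))) :
    EqUpToMap (circ O.obj F)
      ((cocompWreath O.cocomp F).app ((Wreath.flatten (Wreath W)).obj x) ≫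
        (cocompWreath O.cocomp (circ O.obj F)).app x)
      ((cocompWreath O.cocomp F).app ((Wreath.map (Wreath.flatten W)).obj x) ≫
        (circMap O.obj (cocompWreath O.cocomp F)).app x) := by
  let bases : Wreath (Wreath FinBij) :=
    ⟨x.base, fun s => ⟨(x.fam s).base, fun t => ((x.fam s).fam t).base⟩⟩
  let e := Equiv.sigmaAssoc fun s t => ((x.fam s).fam t).base.carrier
  let y := (Wreath.flatten W).obj ((Wreath.map (Wreath.flatten W)).obj x)
  let z := (Wreath.flatten W).obj ((Wreath.flatten (Wreath W)).obj x)
  refine ⟨y.reindex (S := z.base) e,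
    Eq.trans ?_ (congr_arg (· ≫ _) (circ_map_reindex O.obj F (S := z.base) y e).symm)⟩
  exact transfer_merge_assoc (K := fun i j => ((x.fam i).fam j).base.carrier)
    (P' := fun i j => O.obj.obj ((x.fam i).fam j).base) (O.coassoc bases)
    fun i j k => F.obj (((x.fam i).fam j).fam k)

variable (x : Wreath W)

theorem cocompWreath_counit_left :
    EqUpToMap (circ O.obj F) (y := x)
      ((cocompWreath O.cocomp F).app ((Wreath.point (Wreath W)).obj x) ≫
        (counitPoint O.counit (circ O.obj F)).app x)
      (𝟙 ((circ O.obj F).obj x)) := by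
  let e := Equiv.uniqueSigma fun _ : PUnit => x.base.carrier
  have counit := eq_map_homOf O.obj (S := Wreath.total.obj ((Wreath.point FinBij).obj x.base))
    (T := x.base) e (O.counit_left x.base)
  let z := (Wreath.flatten W).obj ((Wreath.point (Wreath W)).obj x)
  refine .of_eq_map (x.reindex (S := z.base) e)
    (Eq.trans ?_ (circ_map_reindex O.obj F (S := z.base) x e).symm)
  exact (transfer_merge_tensPoint (P := O.obj.obj x.base)
    (O.cocomp.app ((Wreath.point FinBij).obj x.base)) (counitPt O.counit)
    fun s => F.obj (x.fam s)).trans (congr_arg (· ⊗ₘ _) counit)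

theorem cocompWreath_counit_right :
    EqUpToMap (circ O.obj F) (y := x)
      ((cocompWreath O.cocomp F).app ((Wreath.map (Wreath.point W)).obj x) ≫
        (circMap O.obj (counitPoint O.counit F)).app x)
      (𝟙 ((circ O.obj F).obj x)) := by
  let e := Equiv.sigmaPUnit x.base.carrier
  have counit := eq_map_homOf O.obj (S := Wreath.total.obj ⟨x.base, fun _ => ⟨PUnit⟩⟩)
    (T := x.base) e (O.counit_right x.base)
  let z := (Wreath.flatten W).obj ((Wreath.map (Wreath.point W)).obj x)
  refine .of_eq_map (x.reindex (S := z.base) e)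
    (Eq.trans ?_ (circ_map_reindex O.obj F (S := z.base) x e).symm)
  exact (transfer_merge_tensUnit (O.cocomp.app ⟨x.base, fun _ => ⟨PUnit⟩⟩) (counitPt O.counit)
    fun s => F.obj (x.fam s)).trans (congr_arg (· ⊗ₘ _) counit)

end CocompWreath

end Circ

namespace Coalgebra

section TreeTransformations

variable {C : Type u} [Category.{v} C] [MonoidalCategory C] [SymmetricCategory C] [HasTerminal C]
  {O : Cooperad C} (c : Coalgebra O)

theorem faceTrans_faceTrans (n : ℕ) (i j : Fin (n + 1)) (h : i ≤ j) (x : Level (n + 2)) :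
    EqUpToMap (c.treeFunctor n)
      ((c.faceTrans n j).app ((face (n + 1) i.castSucc).obj x) ≫
        (c.faceTrans (n + 1) i.castSucc).app x)
      ((c.faceTrans n i).app ((face (n + 1) j.succ).obj x) ≫
        (c.faceTrans (n + 1) j.succ).app x) := by
  induction n with
  | zero =>
    obtain rfl : i = 0 := Subsingleton.elim (α := Fin 1) _ _
    obtain rfl : j = 0 := Subsingleton.elim (α := Fin 1) _ _
    exact .of_eq (c.coassoc x)
  | succ n ih =>
    rcases i with ⟨_ | i, hi⟩ <;> rcases j with ⟨_ | j, hj⟩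
    · exact cocompWreath_coassoc O (c.treeFunctor n) x
    · exact .of_eq (cocompWreath_natural O.cocomp (c.faceTrans n ⟨j, by omega⟩) x).symm
    · simp at h
    · exact .whisker_comp O.obj fun s =>
        ih ⟨i, by omega⟩ ⟨j, by omega⟩ (by simpa using h) (x.fam s)

theorem degenTrans_degenTrans (n : ℕ) (i j : Fin (n + 1)) (h : i ≤ j) (x : Level n) :
    EqUpToMap (c.treeFunctor (n + 2))
      ((c.degenTrans (n + 1) j.succ).app ((degen n i).obj x) ≫ (c.degenTrans n i).app x)
      ((c.degenTrans (n + 1) i.castSucc).app ((degen n j).obj x) ≫ (c.degenTrans n j).app x) := by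
  induction n with
  | zero =>
    obtain rfl : i = 0 := Subsingleton.elim (α := Fin 1) _ _
    obtain rfl : j = 0 := Subsingleton.elim (α := Fin 1) _ _
    exact .of_eq (tensHom_comp_tensPoint (counitPt O.counit) ((c.degenTrans 0 0).app x))
  | succ n ih =>
    rcases i with ⟨_ | i, hi⟩
    · exact .of_eq (tensHom_comp_tensPoint (counitPt O.counit) ((c.degenTrans (n + 1) j).app x))
    · rcases j with ⟨_ | j, hj⟩
      · simp at h
      · exact .whisker_comp O.obj fun s =>
          ih ⟨i, by omega⟩ ⟨j, by omega⟩ (by simpa using h) (x.fam s)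

theorem faceTrans_degenTrans_self (n : ℕ) (i : Fin (n + 1)) (x : Level n) :
    EqUpToMap (c.treeFunctor n)
      ((c.faceTrans n i).app ((degen n i).obj x) ≫ (c.degenTrans n i).app x)
      (𝟙 ((c.treeFunctor n).obj x)) := by
  induction n with
  | zero =>
    obtain rfl : i = 0 := Subsingleton.elim (α := Fin 1) _ _
    have := x.2
    exact .of_eq_map (ObjectProperty.homMk (FinBij.homOf (Equiv.equivOfIsEmpty PEmpty x.1.carrier)))
      (c.counit x)
  | succ n ih =>
    rcases i with ⟨_ | i, hi⟩
    · exact cocompWreath_counit_left O (c.treeFunctor n) x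
    · exact .whisker_comp_id O.obj fun s => ih ⟨i, by omega⟩ (x.fam s)

theorem faceTrans_degenTrans_succ (n : ℕ) (i : Fin (n + 1)) (x : Level (n + 1)) :
    EqUpToMap (c.treeFunctor (n + 1))
      ((c.faceTrans (n + 1) i.castSucc).app ((degen (n + 1) i.succ).obj x) ≫
        (c.degenTrans (n + 1) i.succ).app x)
      (𝟙 ((c.treeFunctor (n + 1)).obj x)) := by
  induction n with
  | zero =>
    obtain rfl : i = 0 := Subsingleton.elim (α := Fin 1) _ _
    exact cocompWreath_counit_right O (c.treeFunctor 0) x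
  | succ n ih =>
    rcases i with ⟨_ | i, hi⟩
    · exact cocompWreath_counit_right O (c.treeFunctor (n + 1)) x
    · exact .whisker_comp_id O.obj fun s => ih ⟨i, by omega⟩ (x.fam s)

theorem faceTrans_degenTrans_of_le (n : ℕ) (i : Fin (n + 2)) (j : Fin (n + 1))
    (h : i ≤ j.castSucc) (x : Level (n + 2)) :
    EqUpToMap (c.treeFunctor (n + 2))
      ((c.faceTrans (n + 2) i.castSucc).app ((degen (n + 2) j.succ.succ).obj x) ≫
        (c.degenTrans (n + 2) j.succ.succ).app x)
      ((c.degenTrans (n + 1) j.succ).app ((face (n + 1) i).obj x) ≫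
        (c.faceTrans (n + 1) i).app x) := by
  induction n with
  | zero =>
    obtain rfl : j = 0 := Subsingleton.elim (α := Fin 1) _ _
    obtain rfl : i = 0 := by simpa using h
    exact .of_eq (cocompWreath_natural O.cocomp (c.degenTrans 0 0) x)
  | succ n ih =>
    rcases i with ⟨_ | i, hi⟩
    · exact .of_eq (cocompWreath_natural O.cocomp (c.degenTrans (n + 1) j) x)
    · rcases j with ⟨_ | j, hj⟩
      · simp at h
      · exact .whisker_comp O.obj fun s =>
          ih ⟨i, by omega⟩ ⟨j, by omega⟩ (by simpa using h) (x.fam s)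

theorem faceTrans_degenTrans_of_ge (n : ℕ) (i j : Fin (n + 1)) (h : j ≤ i) (x : Level (n + 1)) :
    EqUpToMap (c.treeFunctor (n + 1))
      ((c.faceTrans (n + 1) i.succ).app ((degen (n + 1) j.castSucc).obj x) ≫
        (c.degenTrans (n + 1) j.castSucc).app x)
      ((c.degenTrans n j).app ((face n i).obj x) ≫ (c.faceTrans n i).app x) := by
  induction n with
  | zero =>
    obtain rfl : i = 0 := Subsingleton.elim (α := Fin 1) _ _
    obtain rfl : j = 0 := Subsingleton.elim (α := Fin 1) _ _
    exact .of_eq (tensHom_comp_tensPoint (counitPt O.counit) ((c.faceTrans 0 0).app x))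
  | succ n ih =>
    rcases j with ⟨_ | j, hj⟩
    · exact .of_eq (tensHom_comp_tensPoint (counitPt O.counit) ((c.faceTrans (n + 1) i).app x))
    · rcases i with ⟨_ | i, hi⟩
      · simp at h
      · exact .whisker_comp O.obj fun s =>
          ih ⟨i, by omega⟩ ⟨j, by omega⟩ (by simpa using h) (x.fam s)

end TreeTransformations

end Coalgebra

instance sigma0_subsingleton_hom (E E' : Sigma0) : Subsingleton (E ⟶ E') where
  allEq _ _ :=
    ObjectProperty.hom_ext _ (Equiv.ext fun s => (E.2.false s).elim)

/-- The empty set is initial in `Σ_0`. -/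
def emptyIsInitial : IsInitial empty :=
  IsInitial.ofUniqueHom
    (fun E =>
      have := E.2
      ObjectProperty.homMk (FinBij.homOf (Equiv.equivOfIsEmpty PEmpty E.1.carrier)))
    fun _ _ => Subsingleton.elim _ _

namespace Coalgebra

section Term

variable {C : Type u} [Category.{v} C] [MonoidalCategory C] [SymmetricCategory C] [HasLimits C]
  {O : Cooperad C} (c : Coalgebra O)

/-- The projection of `O^{∘̂ n} ∘̂ c` to the value of `O^{⊚ n} ⊚ c` at a tree. -/
noncomputable def termProj (n : ℕ) (x : Level n) : c.term n ⟶ (c.treeFunctor n).obj x :=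
  (c.proj n).app x

theorem termProj_map {n : ℕ} {x y : Level n} (a : x ⟶ y) :
    c.termProj n x ≫ (c.treeFunctor n).map a = c.termProj n y := by
  have gam_map : (gam n ⋙ c.kan n).map a = 𝟙 (c.term n) := (c.kan n).map_id empty
  refine ((c.proj n).naturality a).symm.trans ?_
  rw [gam_map]
  exact Category.id_comp _

theorem termProj_comp_eq_of_eqUpToMap {n : ℕ} {A : C} {x y : Level n}
    {f : (c.treeFunctor n).obj x ⟶ A} {g : (c.treeFunctor n).obj y ⟶ A}
    (h : EqUpToMap (c.treeFunctor n) f g) : c.termProj n x ≫ f = c.termProj n y ≫ g := by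
  obtain ⟨a, rfl⟩ := h
  rw [← Category.assoc, termProj_map]

/-- The natural transformation from a constant functor that extends a morphism at `∅`. -/
noncomputable def constToKan {n : ℕ} {A : C} (f : A ⟶ c.term n) :
    (Functor.const Sigma0).obj A ⟶ c.kan n :=
  (Functor.const Sigma0).map f ≫ (coneOfDiagramInitial emptyIsInitial (c.kan n)).π

theorem constToKan_app_empty {n : ℕ} {A : C} (f : A ⟶ c.term n) :
    (c.constToKan f).app empty = f := by
  have map_to_self : (c.kan n).map (emptyIsInitial.to empty) = 𝟙 (c.term n) := by
    rw [emptyIsInitial.to_self]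
    exact (c.kan n).map_id empty
  exact (congr_arg (f ≫ ·) map_to_self).trans (Category.comp_id f)

theorem term_hom_ext {n : ℕ} {A : C} {f g : A ⟶ c.term n}
    (h : ∀ x, f ≫ c.termProj n x = g ≫ c.termProj n x) : f = g := by
  have app_comp_proj (k : A ⟶ c.term n) (x : Level n) :
      (Functor.whiskerLeft (gam n) (c.constToKan k) ≫ c.proj n).app x = k ≫ c.termProj n x :=
    congr_arg (· ≫ c.termProj n x) (c.constToKan_app_empty k)
  have constToKan_eq : c.constToKan f = c.constToKan g := by
    refine (c.kan n).hom_ext_of_isRightKanExtension (c.proj n) _ _ ?_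
    ext x
    rw [app_comp_proj, app_comp_proj, h]
  rw [← c.constToKan_app_empty f, constToKan_eq, constToKan_app_empty]

theorem coface_termProj (n : ℕ) (i : Fin (n + 1)) (x : Level (n + 1)) :
    c.coface n i ≫ c.termProj (n + 1) x =
      c.termProj n ((face n i).obj x) ≫ (c.faceTrans n i).app x :=
  (c.kan (n + 1)).liftOfIsRightKanExtension_fac_app (c.proj (n + 1)) (c.kan n)
    (Functor.whiskerLeft (face n i) (c.proj n) ≫ c.faceTrans n i) x

theorem codegen_termProj (n : ℕ) (i : Fin (n + 1)) (x : Level n) :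
    c.codegen n i ≫ c.termProj n x =
      c.termProj (n + 1) ((degen n i).obj x) ≫ (c.degenTrans n i).app x :=
  (c.kan n).liftOfIsRightKanExtension_fac_app (c.proj n) (c.kan (n + 1))
    (Functor.whiskerLeft (degen n i) (c.proj (n + 1)) ≫ c.degenTrans n i) x

theorem coaug_termProj (x : Level 1) : c.coaug ≫ c.termProj 1 x = c.comul.app x :=
  (c.kan 1).liftOfIsRightKanExtension_fac_app (c.proj 1) ((Functor.const Sigma0).obj c.obj)
    c.comul x

theorem coface_coface (n : ℕ) (i j : Fin (n + 1)) (h : i ≤ j) :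
    c.coface n i ≫ c.coface (n + 1) j.succ = c.coface n j ≫ c.coface (n + 1) i.castSucc := by
  refine c.term_hom_ext fun x => ?_
  rw [Category.assoc, Category.assoc, coface_termProj, coface_termProj,
    reassoc_of% c.coface_termProj, reassoc_of% c.coface_termProj]
  exact (c.termProj_comp_eq_of_eqUpToMap (c.faceTrans_faceTrans n i j h x)).symm

theorem codegen_codegen (n : ℕ) (i j : Fin (n + 1)) (h : i ≤ j) :
    c.codegen (n + 1) j.succ ≫ c.codegen n i = c.codegen (n + 1) i.castSucc ≫ c.codegen n j := by
  refine c.term_hom_ext fun x => ?_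
  rw [Category.assoc, Category.assoc, codegen_termProj, codegen_termProj,
    reassoc_of% c.codegen_termProj, reassoc_of% c.codegen_termProj]
  exact c.termProj_comp_eq_of_eqUpToMap (c.degenTrans_degenTrans n i j h x)

theorem coface_codegen_self (n : ℕ) (i : Fin (n + 1)) :
    c.coface n i ≫ c.codegen n i = 𝟙 (c.term n) := by
  refine c.term_hom_ext fun x => ?_
  rw [Category.assoc, codegen_termProj, reassoc_of% c.coface_termProj, Category.id_comp,
    c.termProj_comp_eq_of_eqUpToMap (c.faceTrans_degenTrans_self n i x), Category.comp_id]

theorem coface_codegen_succ (n : ℕ) (i : Fin (n + 1)) :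
    c.coface (n + 1) i.castSucc ≫ c.codegen (n + 1) i.succ = 𝟙 (c.term (n + 1)) := by
  refine c.term_hom_ext fun x => ?_
  rw [Category.assoc, codegen_termProj, reassoc_of% c.coface_termProj, Category.id_comp,
    c.termProj_comp_eq_of_eqUpToMap (c.faceTrans_degenTrans_succ n i x), Category.comp_id]

theorem coface_codegen_of_le (n : ℕ) (i : Fin (n + 2)) (j : Fin (n + 1)) (h : i ≤ j.castSucc) :
    c.coface (n + 2) i.castSucc ≫ c.codegen (n + 2) j.succ.succ =
      c.codegen (n + 1) j.succ ≫ c.coface (n + 1) i := by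
  refine c.term_hom_ext fun x => ?_
  rw [Category.assoc, Category.assoc, codegen_termProj, coface_termProj,
    reassoc_of% c.coface_termProj, reassoc_of% c.codegen_termProj]
  exact c.termProj_comp_eq_of_eqUpToMap (c.faceTrans_degenTrans_of_le n i j h x)

theorem coface_codegen_of_ge (n : ℕ) (i j : Fin (n + 1)) (h : j ≤ i) :
    c.coface (n + 1) i.succ ≫ c.codegen (n + 1) j.castSucc = c.codegen n j ≫ c.coface n i := by
  refine c.term_hom_ext fun x => ?_
  rw [Category.assoc, Category.assoc, codegen_termProj, coface_termProj,
    reassoc_of% c.coface_termProj, reassoc_of% c.codegen_termProj]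
  exact c.termProj_comp_eq_of_eqUpToMap (c.faceTrans_degenTrans_of_ge n i j h x)

/-- The identification of `O^{∘̂ 0} ∘̂ c` with `c`. -/
noncomputable def termZero : c.term 0 ⟶ c.obj :=
  c.termProj 0 empty

theorem termZero_coaug : c.termZero ≫ c.coaug = c.coface 0 0 := by
  refine c.term_hom_ext fun x => ?_
  rw [Category.assoc, coaug_termProj, coface_termProj]
  rfl

theorem codegen_termZero : c.codegen 0 0 ≫ c.termZero = c.coaugRetract :=
  c.codegen_termProj 0 0 empty

theorem coaug_coaugRetract : c.coaug ≫ c.coaugRetract = 𝟙 c.obj := by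
  have proj := c.coaug_termProj ((Wreath.point Sigma0).obj empty)
  exact ((Category.assoc _ _ _).symm.trans (congr_arg (· ≫ _) proj)).trans (c.counit empty)

theorem coface_codegen_one : c.coface 1 1 ≫ c.codegen 1 0 = c.coaugRetract ≫ c.coaug := by
  rw [← codegen_termZero, Category.assoc, termZero_coaug]
  exact c.coface_codegen_of_ge 0 0 0 le_rfl

theorem codegen_coaugRetract : c.codegen 1 1 ≫ c.coaugRetract = c.codegen 1 0 ≫ c.coaugRetract := by
  have codegen_comm : c.codegen 1 1 ≫ c.codegen 0 0 = c.codegen 1 0 ≫ c.codegen 0 0 :=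
    c.codegen_codegen 0 0 0 le_rfl
  rw [← codegen_termZero, reassoc_of% codegen_comm]

theorem coaug_coface : c.coaug ≫ c.coface 1 0 = c.coaug ≫ c.coface 1 1 := by
  have factor : c.coaug = (c.coaug ≫ c.codegen 0 0) ≫ c.coface 0 0 := by
    rw [← termZero_coaug, Category.assoc, reassoc_of% c.codegen_termZero,
      reassoc_of% c.coaug_coaugRetract]
  rw [factor]
  simp only [Category.assoc]
  exact congr_arg (fun f => c.coaug ≫ c.codegen 0 0 ≫ f) (c.coface_coface 0 0 0 le_rfl).symm

end Term

end Coalgebra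

section Presentation

open SimplexCategoryGenRel

theorem eq_eqToHom_or_eq_comp_δ_of_P_δ {n : ℕ} {x : SimplexCategoryGenRel} {f : x ⟶ mk (n + 1)}
    (hf : P_δ f) :
    (∃ h : x = mk (n + 1), f = eqToHom h) ∨
      ∃ (i : Fin (n + 2)) (g : x ⟶ mk n), P_δ g ∧ f = g ≫ δ i := by
  cases hf with
  | of _ hδ => cases hδ; exact .inr ⟨_, 𝟙 _, P_δ.id_mem _, (Category.id_comp _).symm⟩
  | id => exact .inl ⟨rfl, rfl⟩
  | comp_of f g hf hg => cases hg; exact .inr ⟨_, f, hf, rfl⟩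

theorem toSimplexCategory_map_comp_δ {n : ℕ} {x : SimplexCategoryGenRel} (g : x ⟶ mk n)
    (j : Fin (n + 2)) (k : Fin (x.len + 1)) :
    (toSimplexCategory.map (g ≫ δ j)).toOrderHom k =
      j.succAbove ((toSimplexCategory.map g).toOrderHom k) := by
  rw [Functor.map_comp]
  rfl

theorem map_comp_δ_ne_of_succAbove_eq {n : ℕ} {x : SimplexCategoryGenRel} {g : x ⟶ mk n}
    {i j : Fin (n + 2)} {i' : Fin (n + 1)} (hi' : j.succAbove i' = i)
    (hi : ∀ k, (toSimplexCategory.map (g ≫ δ j)).toOrderHom k ≠ i) (k : Fin (x.len + 1)) :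
    (toSimplexCategory.map g).toOrderHom k ≠ i' := by
  rintro rfl
  exact hi k ((toSimplexCategory_map_comp_δ g j k).trans hi')

theorem exists_eq_comp_δ_of_P_δ_of_ne {n : ℕ} {x : SimplexCategoryGenRel} {f : x ⟶ mk (n + 1)}
    (hf : P_δ f) (i : Fin (n + 2)) (hi : ∀ k, (toSimplexCategory.map f).toOrderHom k ≠ i) :
    ∃ g : x ⟶ mk n, P_δ g ∧ f = g ≫ δ i := by
  induction n with
  | zero =>
    obtain ⟨rfl, rfl⟩ | ⟨j, g, hg, rfl⟩ := eq_eqToHom_or_eq_comp_δ_of_P_δ hf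
    · exact absurd rfl (hi i)
    · obtain rfl | i_ne_j := eq_or_ne i j
      · exact ⟨g, hg, rfl⟩
      · obtain ⟨k, hk⟩ := Fin.exists_succAbove_eq i_ne_j
        exact absurd (Subsingleton.elim (α := Fin 1) _ _) (map_comp_δ_ne_of_succAbove_eq hk hi 0)
  | succ n ih =>
    obtain ⟨rfl, rfl⟩ | ⟨j, g, hg, rfl⟩ := eq_eqToHom_or_eq_comp_δ_of_P_δ hf
    · exact absurd rfl (hi i)
    · obtain i_lt_j | rfl | j_lt_i := lt_trichotomy i j
      · obtain ⟨i, rfl⟩ := Fin.eq_castSucc_of_ne_last (Fin.ne_last_of_lt i_lt_j)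
        obtain ⟨j, rfl⟩ := Fin.eq_succ_of_ne_zero (Fin.ne_zero_of_lt i_lt_j)
        obtain ⟨g', hg', rfl⟩ := ih hg i
          (map_comp_δ_ne_of_succAbove_eq (Fin.succAbove_of_castSucc_lt j.succ i i_lt_j) hi)
        refine ⟨g' ≫ δ j, P_δ.comp_mem _ _ hg' (P_δ.δ j), ?_⟩
        rw [Category.assoc, Category.assoc, δ_comp_δ (Fin.castSucc_lt_succ_iff.1 i_lt_j)]
      · exact ⟨g, hg, rfl⟩
      · obtain ⟨j, rfl⟩ := Fin.eq_castSucc_of_ne_last (Fin.ne_last_of_lt j_lt_i)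
        obtain ⟨i, rfl⟩ := Fin.eq_succ_of_ne_zero (Fin.ne_zero_of_lt j_lt_i)
        have j_le_i : j ≤ i := Fin.castSucc_lt_succ_iff.1 j_lt_i
        obtain ⟨g', hg', rfl⟩ := ih hg i
          (map_comp_δ_ne_of_succAbove_eq (Fin.succAbove_of_le_castSucc j.castSucc i j_le_i) hi)
        refine ⟨g' ≫ δ j, P_δ.comp_mem _ _ hg' (P_δ.δ j), ?_⟩
        rw [Category.assoc, Category.assoc, ← δ_comp_δ j_le_i]

theorem eq_of_map_eq_of_P_δ {n : ℕ} {x : SimplexCategoryGenRel} {f g : x ⟶ mk n} (hf : P_δ f)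
    (hg : P_δ g) (h : toSimplexCategory.map f = toSimplexCategory.map g) : f = g := by
  induction n with
  | zero =>
    obtain ⟨rfl, rfl⟩ | len_lt := eq_or_len_le_of_P_δ hf
    · obtain ⟨_, rfl⟩ | len_lt := eq_or_len_le_of_P_δ hg
      · rfl
      · simp at len_lt
    · simp at len_lt
  | succ n ih =>
    obtain ⟨rfl, rfl⟩ | ⟨i, f', hf', rfl⟩ := eq_eqToHom_or_eq_comp_δ_of_P_δ hf
    · obtain ⟨_, rfl⟩ | len_lt := eq_or_len_le_of_P_δ hg
      · rfl
      · simp at len_lt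
    · have map_g_ne (k) : (toSimplexCategory.map g).toOrderHom k ≠ i := by
        rw [← h]
        exact ne_of_eq_of_ne (toSimplexCategory_map_comp_δ f' i k) (Fin.succAbove_ne i _)
      obtain ⟨g', hg', rfl⟩ := exists_eq_comp_δ_of_P_δ_of_ne hg i map_g_ne
      rw [Functor.map_comp, Functor.map_comp] at h
      have : Mono (toSimplexCategory.map (δ i)) := inferInstanceAs (Mono (SimplexCategory.δ i))
      rw [ih hf' hg' ((cancel_mono _).1 h)]

/- The normal form of a composite of degeneracies is the increasing list of the `j` at which the
underlying monotone map takes the same value as at `j + 1`. -/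
theorem eq_of_map_eq_of_P_σ {x y : SimplexCategoryGenRel} {f g : x ⟶ y} (hf : P_σ f)
    (hg : P_σ g) (h : toSimplexCategory.map f = toSimplexCategory.map g) : f = g := by
  obtain ⟨L, m, b, rfl, rfl, rfl, hL, rfl⟩ := exists_normal_form_P_σ f hf
  obtain ⟨L', m', b', target_eq, source_eq, rfl, hL', rfl⟩ := exists_normal_form_P_σ g hg
  obtain rfl : m' = m := congr_arg len target_eq
  have length_eq : L.length = L'.length :=
    Nat.add_left_cancel (n := m') (congr_arg len source_eq)
  have eval_eq : ∀ j < m' + L.length + 1, simplicialEvalσ L j = simplicialEvalσ L' j := by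
    intro j hj
    rw [← simplicialEvalσ_of_isAdmissible L _ _ hL rfl j hj,
      ← simplicialEvalσ_of_isAdmissible L' _ _ hL' (by omega) j hj]
    exact congr_arg (fun k : SimplexCategory.mk (m' + L.length) ⟶ SimplexCategory.mk m' =>
      (k.toOrderHom ⟨j, hj⟩ : ℕ)) h
  have mem_iff (j : ℕ) : j ∈ L ↔ j ∈ L' := by
    rw [mem_isAdmissible_iff L hL, mem_isAdmissible_iff L' hL', length_eq]
    refine and_congr_right fun hj => ?_
    rw [eval_eq j (by omega), eval_eq (j + 1) (by omega)]
  obtain rfl : L = L' :=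
    (List.perm_ext_iff_of_nodup hL.sortedLT.nodup hL'.sortedLT.nodup).2 mem_iff
      |>.eq_of_pairwise (fun _ _ _ _ lt gt => absurd lt gt.asymm)
        hL.sortedLT.pairwise hL'.sortedLT.pairwise
  rfl

theorem mono_section_comp_of_comp_eq {D : Type*} [Category D] {x y z z' : D} {e : x ⟶ z}
    {m : z ⟶ y} {e' : x ⟶ z'} {m' : z' ⟶ y} [IsSplitEpi e] [Mono m] (h : e ≫ m = e' ≫ m') :
    (section_ e ≫ e') ≫ m' = m ∧ Mono (section_ e ≫ e') := by
  have fac : (section_ e ≫ e') ≫ m' = m := by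
    rw [Category.assoc, ← h, IsSplitEpi.id_assoc]
  exact ⟨fac, mono_of_mono_fac fac⟩

/- The two epi-mono factorizations of the common image in the simplex category agree: the comparison
maps between their middle objects are monomorphisms in both directions. -/
instance toSimplexCategory_faithful : toSimplexCategory.Faithful where
  map_injective {x y} f f' h := by
    obtain ⟨z, e, m, he, hm, rfl⟩ := exists_P_σ_P_δ_factorization f
    obtain ⟨z', e', m', he', hm', rfl⟩ := exists_P_σ_P_δ_factorization f'
    have := isSplitEpi_toSimplexCategory_map_of_P_σ he
    have := isSplitEpi_toSimplexCategory_map_of_P_σ he'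
    have := isSplitMono_toSimplexCategory_map_of_P_δ hm
    have := isSplitMono_toSimplexCategory_map_of_P_δ hm'
    rw [Functor.map_comp, Functor.map_comp] at h
    obtain ⟨comparison_fac, _⟩ := mono_section_comp_of_comp_eq h
    obtain ⟨_, _⟩ := mono_section_comp_of_comp_eq h.symm
    obtain rfl : z = z' := SimplexCategoryGenRel.ext
      (le_antisymm
        (SimplexCategory.len_le_of_mono
          (section_ (toSimplexCategory.map e) ≫ toSimplexCategory.map e'))
        (SimplexCategory.len_le_of_mono
          (section_ (toSimplexCategory.map e') ≫ toSimplexCategory.map e)))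
    rw [SimplexCategory.eq_id_of_mono (section_ _ ≫ toSimplexCategory.map e'),
      Category.id_comp] at comparison_fac
    rw [comparison_fac, cancel_mono] at h
    obtain ⟨n⟩ := y
    rw [eq_of_map_eq_of_P_σ he he' h, eq_of_map_eq_of_P_δ hm hm' comparison_fac.symm]

theorem exists_toSimplexCategory_map_eq {a b : SimplexCategory} (f : a ⟶ b) :
    ∃ g : mk a.len ⟶ mk b.len, toSimplexCategory.map g = f := by
  let presented : MorphismProperty SimplexCategory := fun a b f =>
    ∃ g : mk a.len ⟶ mk b.len, toSimplexCategory.map g = f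
  have : presented.IsMultiplicative :=
    { id_mem := fun _ => ⟨𝟙 _, toSimplexCategory.map_id _⟩
      comp_mem := by
        rintro _ _ _ _ _ ⟨f, rfl⟩ ⟨g, rfl⟩
        exact ⟨f ≫ g, toSimplexCategory.map_comp _ _⟩ }
  have presented_eq_top : presented = ⊤ :=
    SimplexCategory.morphismProperty_eq_top presented (fun i => ⟨δ i, rfl⟩) fun i => ⟨σ i, rfl⟩
  exact presented_eq_top.ge f trivial

instance toSimplexCategory_full : toSimplexCategory.Full where
  map_surjective f := exists_toSimplexCategory_map_eq f

/-- The functor that writes the morphisms of the simplex category in terms of faces and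
degeneracies. It is inverse to `toSimplexCategory` on objects by definition. -/
noncomputable def simplexToGenRel : SimplexCategory ⥤ SimplexCategoryGenRel where
  obj a := mk a.len
  map {a b} f := toSimplexCategory.preimage (X := mk a.len) (Y := mk b.len) f
  map_id _ := toSimplexCategory.preimage_id
  map_comp {a b d} f g :=
    toSimplexCategory.preimage_comp (X := mk a.len) (Y := mk b.len) (Z := mk d.len) f g

theorem simplexToGenRel_map_δ {n : ℕ} (i : Fin (n + 2)) :
    simplexToGenRel.map (SimplexCategory.δ i) = δ i :=
  toSimplexCategory.preimage_map (δ i)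

theorem simplexToGenRel_map_σ {n : ℕ} (i : Fin (n + 1)) :
    simplexToGenRel.map (SimplexCategory.σ i) = σ i :=
  toSimplexCategory.preimage_map (σ i)

end Presentation

theorem comp_map_eq_of_comp_δ_eq {C : Type u} [Category.{v} C] (X : CosimplicialObject C) {A : C}
    {f : A ⟶ X.obj (SimplexCategory.mk 0)} (hf : f ≫ X.δ 0 = f ≫ X.δ 1) (a : SimplexCategory)
    (p q : SimplexCategory.mk 0 ⟶ a) : f ≫ X.map p = f ≫ X.map q := by
  wlog p_le_q : p.toOrderHom 0 ≤ q.toOrderHom 0 generalizing p q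
  · exact (this q p (le_of_not_ge p_le_q)).symm
  let edge : SimplexCategory.mk 1 ⟶ a := SimplexCategory.mkOfLe (n := a.len) _ _ p_le_q
  have p_eq : p = SimplexCategory.δ 1 ≫ edge := SimplexCategory.Hom.ext_zero_left _ _
  have q_eq : q = SimplexCategory.δ 0 ≫ edge := SimplexCategory.Hom.ext_zero_left _ _
  calc
    f ≫ X.map p = (f ≫ X.δ 1) ≫ X.map edge := by
      rw [p_eq, X.map_comp, Category.assoc]
      rfl
    _ = (f ≫ X.δ 0) ≫ X.map edge := by rw [hf]
    _ = f ≫ X.map q := by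
      rw [q_eq, X.map_comp, Category.assoc]
      rfl

/-- A cosimplicial object given by generators and relations: objects `X^n` with cofaces and
codegeneracies that satisfy the cosimplicial identities. -/
structure CosimplicialDatum (C : Type u) [Category.{v} C] where
  obj : ℕ → C
  δ : ∀ {n : ℕ}, Fin (n + 2) → (obj n ⟶ obj (n + 1))
  σ : ∀ {n : ℕ}, Fin (n + 1) → (obj (n + 1) ⟶ obj n)
  δ_comp_δ : ∀ {n : ℕ} {i j : Fin (n + 2)}, i ≤ j → δ i ≫ δ j.succ = δ j ≫ δ i.castSucc
  δ_comp_σ_of_le : ∀ {n : ℕ} {i : Fin (n + 2)} {j : Fin (n + 1)}, i ≤ j.castSucc →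
    δ i.castSucc ≫ σ j.succ = σ j ≫ δ i
  δ_comp_σ_self : ∀ {n : ℕ} (i : Fin (n + 1)), δ i.castSucc ≫ σ i = 𝟙 (obj n)
  δ_comp_σ_succ : ∀ {n : ℕ} (i : Fin (n + 1)), δ i.succ ≫ σ i = 𝟙 (obj n)
  δ_comp_σ_of_gt : ∀ {n : ℕ} {i : Fin (n + 2)} {j : Fin (n + 1)}, j.castSucc < i →
    δ i.succ ≫ σ j.castSucc = σ j ≫ δ i
  σ_comp_σ : ∀ {n : ℕ} {i j : Fin (n + 1)}, i ≤ j → σ i.castSucc ≫ σ j = σ j.succ ≫ σ i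

namespace CosimplicialDatum

variable {C : Type u} [Category.{v} C] (X : CosimplicialDatum C)

/-- The representation of the quiver of faces and degeneracies given by a cosimplicial datum. -/
def prefunctor : FreeSimplexQuiver ⥤q C where
  obj n := X.obj n.len
  map
    | .δ i => X.δ i
    | .σ i => X.σ i

theorem lift_prefunctor_map_comp {x y z : FreeSimplexQuiver} (f : x ⟶ y) (g : y ⟶ z) :
    (Paths.lift X.prefunctor).map
        ((Paths.of FreeSimplexQuiver).map f ≫ (Paths.of FreeSimplexQuiver).map g) =
      X.prefunctor.map f ≫ X.prefunctor.map g := by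
  refine (Functor.map_comp _ _ _).trans (congr_arg₂ (· ≫ ·) ?_ ?_) <;> exact Category.id_comp _

/-- The functor that extends a cosimplicial datum to the category presented by the generators and
relations of the simplex category. -/
def genRelFunctor : SimplexCategoryGenRel ⥤ C :=
  CategoryTheory.Quotient.lift _ (Paths.lift X.prefunctor) fun _ _ _ _ h => by
    cases h with
    | δ_comp_δ H =>
      rw [lift_prefunctor_map_comp, lift_prefunctor_map_comp]
      exact X.δ_comp_δ H
    | δ_comp_σ_of_le H =>
      rw [lift_prefunctor_map_comp, lift_prefunctor_map_comp]
      exact X.δ_comp_σ_of_le H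
    | δ_comp_σ_self =>
      rw [lift_prefunctor_map_comp]
      exact X.δ_comp_σ_self _
    | δ_comp_σ_succ =>
      rw [lift_prefunctor_map_comp]
      exact X.δ_comp_σ_succ _
    | δ_comp_σ_of_gt H =>
      rw [lift_prefunctor_map_comp, lift_prefunctor_map_comp]
      exact X.δ_comp_σ_of_gt H
    | σ_comp_σ H =>
      rw [lift_prefunctor_map_comp, lift_prefunctor_map_comp]
      exact X.σ_comp_σ H

theorem genRelFunctor_map_δ {n : ℕ} (i : Fin (n + 2)) :
    X.genRelFunctor.map (SimplexCategoryGenRel.δ i) = X.δ i :=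
  Category.id_comp _

theorem genRelFunctor_map_σ {n : ℕ} (i : Fin (n + 1)) :
    X.genRelFunctor.map (SimplexCategoryGenRel.σ i) = X.σ i :=
  Category.id_comp _

/-- The cosimplicial object given by a cosimplicial datum. -/
noncomputable def cosimplicialObject : CosimplicialObject C :=
  simplexToGenRel ⋙ X.genRelFunctor

theorem cosimplicialObject_δ {n : ℕ} (i : Fin (n + 2)) : X.cosimplicialObject.δ i = X.δ i :=
  (congr_arg X.genRelFunctor.map (simplexToGenRel_map_δ i)).trans (X.genRelFunctor_map_δ i)

theorem cosimplicialObject_σ {n : ℕ} (i : Fin (n + 1)) : X.cosimplicialObject.σ i = X.σ i :=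
  (congr_arg X.genRelFunctor.map (simplexToGenRel_map_σ i)).trans (X.genRelFunctor_map_σ i)

theorem comp_cosimplicialObject_δ {A : C} {f : A ⟶ X.obj 0} (hf : f ≫ X.δ 0 = f ≫ X.δ 1) :
    f ≫ X.cosimplicialObject.δ 0 = f ≫ X.cosimplicialObject.δ 1 :=
  (congr_arg (f ≫ ·) (X.cosimplicialObject_δ 0)).trans <|
    hf.trans (congr_arg (f ≫ ·) (X.cosimplicialObject_δ 1)).symm

/-- The coaugmented cosimplicial object given by a cosimplicial datum `X` and a morphism to `X^0`
that has the same composites with the two cofaces `X^0 ⟶ X^1`. -/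
noncomputable def augmented {A : C} (f : A ⟶ X.obj 0) (hf : f ≫ X.δ 0 = f ≫ X.δ 1) :
    CosimplicialObject.Augmented C :=
  X.cosimplicialObject.augment A f fun a p q =>
    comp_map_eq_of_comp_δ_eq X.cosimplicialObject (X.comp_cosimplicialObject_δ hf) a p q

theorem augmented_hom_app_zero {A : C} (f : A ⟶ X.obj 0) (hf : f ≫ X.δ 0 = f ≫ X.δ 1) :
    (X.augmented f hf).hom.app (SimplexCategory.mk 0) = f :=
  CosimplicialObject.augment_hom_zero _ _ _ _

end CosimplicialDatum

namespace Coalgebra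

variable {C : Type u} [Category.{v} C] [MonoidalCategory C] [SymmetricCategory C] [HasLimits C]
  {O : Cooperad C} (c : Coalgebra O)

/-- The objects `O^{∘̂ (n + 1)} ∘̂ c` with the cofaces `Δ_i` and the codegeneracies `ε_{j + 1}`. -/
noncomputable def cosimplicialDatum : CosimplicialDatum C where
  obj n := c.term (n + 1)
  δ {n} i := c.coface (n + 1) i
  σ {n} j := c.codegen (n + 1) j.succ
  δ_comp_δ {n i j} h := c.coface_coface (n + 1) i j h
  δ_comp_σ_of_le {n i j} h := c.coface_codegen_of_le n i j h
  δ_comp_σ_self {n} i := c.coface_codegen_succ n i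
  δ_comp_σ_succ {n} i := c.coface_codegen_self (n + 1) i.succ
  δ_comp_σ_of_gt {n i j} h :=
    c.coface_codegen_of_ge (n + 1) i j.succ (Fin.castSucc_lt_iff_succ_le.1 h)
  σ_comp_σ {n i j} h :=
    (c.codegen_codegen (n + 1) i.succ j.succ (Fin.succ_le_succ_iff.2 h)).symm

/-- The coaugmented cosimplicial object `c ⟶ O ∘̂ c ⇉ O ∘̂ O ∘̂ c ⋯`. -/
noncomputable def cosimplicial : CosimplicialObject.Augmented C :=
  c.cosimplicialDatum.augmented c.coaug c.coaug_coface

end Coalgebra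

end TreeCooperad

theorem theoremL {C : Type u} [Category.{v} C] [MonoidalCategory C] [SymmetricCategory C]
    [HasLimits C] (O : TreeCooperad.Cooperad C) (c : TreeCooperad.Coalgebra O) :
    -- the coaugmented cosimplicial object, its terms, cofaces and codegeneracies
    (∃ (X : CosimplicialObject.Augmented C) (e₀ : X.left ≅ c.obj)
        (e : ∀ n : ℕ, X.right.obj (SimplexCategory.mk n) ≅ c.term (n + 1)),
      X.hom.app (SimplexCategory.mk 0) ≫ (e 0).hom = e₀.hom ≫ c.coaug ∧
      (∀ (n : ℕ) (i : Fin (n + 2)),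
        X.right.δ i ≫ (e (n + 1)).hom = (e n).hom ≫ c.coface (n + 1) i) ∧
      (∀ (n : ℕ) (j : Fin (n + 1)),
        X.right.σ j ≫ (e n).hom = (e (n + 1)).hom ≫ c.codegen (n + 1) j.succ)) ∧
    -- the extra codegeneracy
    c.coaug ≫ c.coaugRetract = 𝟙 c.obj ∧
    (∀ n : ℕ, c.coface (n + 1) 0 ≫ c.codegen (n + 1) 0 = 𝟙 (c.term (n + 1))) ∧
    c.coface 1 1 ≫ c.codegen 1 0 = c.coaugRetract ≫ c.coaug ∧
    (∀ (n : ℕ) (i : Fin (n + 2)),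
      c.coface (n + 2) i.succ ≫ c.codegen (n + 2) 0 =
        c.codegen (n + 1) 0 ≫ c.coface (n + 1) i) ∧
    c.codegen 1 1 ≫ c.coaugRetract = c.codegen 1 0 ≫ c.coaugRetract ∧
    (∀ (n : ℕ) (j : Fin (n + 1)),
      c.codegen (n + 2) j.succ.succ ≫ c.codegen (n + 1) 0 =
        c.codegen (n + 2) 0 ≫ c.codegen (n + 1) j.succ) := by
  refine ⟨⟨c.cosimplicial, Iso.refl _, fun _ => Iso.refl _, ?_, fun n i => ?_, fun n j => ?_⟩,
    c.coaug_coaugRetract, fun n => c.coface_codegen_self (n + 1) 0, c.coface_codegen_one,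
    fun n i => c.coface_codegen_of_ge (n + 1) i 0 (Fin.zero_le _), c.codegen_coaugRetract,
    fun n j => c.codegen_codegen (n + 1) 0 j.succ (Fin.zero_le _)⟩
  · exact (Category.comp_id _).trans
      ((c.cosimplicialDatum.augmented_hom_app_zero _ _).trans (Category.id_comp c.coaug).symm)
  · exact (Category.comp_id _).trans
      ((c.cosimplicialDatum.cosimplicialObject_δ i).trans (Category.id_comp _).symm)
  · exact (Category.comp_id _).trans
      ((c.cosimplicialDatum.cosimplicialObject_σ j).trans (Category.id_comp _).symm)
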